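/- **Lemma.** All vector spaces are over $\mathbb{C}$. For $c\in\mathbb{C}$ consider the following differential operators in two variables $x,y$: $$J^1_c=x^2\partial_x+xy\partial_y-cx,\quad J^2_c=xy\partial_x+y^2\partial_y-cy,\quad J^3_c=y\partial_x,\quad J^4_c=\partial_x,$$ $$J^5_c=\partial_y,\quad J^6_c=x\partial_y,\quad J^7_c=x\partial_x-\tfrac c3,\quad J^8_c=y\partial_y-\tfrac c3 .$$ Let $\mathfrak D$ be the associative algebra of $2\times2$ matrices of linear operators on $\mathbb{C}[x,y]$; it contains the $2\times 2$ matrix differential operators in $x,y$ with polynomial coefficients. Regard $\mathfrak D$ as a Lie superalgebra in which diagonal matrices are even, off-diagonal matrices are odd, and $[A,B]_s=AB-(-1)^{\deg A\deg B}BA$ for homogeneous $A,B$. Put $\sigma^+=\begin{pmatrix}0&1\\0&0\end{pmatrix}$, $\sigma^-=\begin{pmatrix}0&0\\1&0\end{pmatrix}$, $\sigma_3=\operatorname{diag}(1,-1)$. For integers $0\le\Delta\le n$ let $\mathfrak s^\Delta_n\subset\mathfrak D$ be the Lie superalgebra generated by the matrix differential operators $$T^i=\operatorname{diag}(J^i_{n-\Delta},J^i_n)\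 (1\le i\le 8),\qquad J=\tfrac13\operatorname{diag}(n+2\Delta,n),$$ $$Q^-_{\alpha\beta}=x^\alpha y^\beta\,\sigma^-,\qquad Q^+_{\alpha\beta}=\Big(\prod_{k=1}^{\Delta-\alpha-\beta}(x\partial_x+y\partial_y-n+\Delta-k)\Big)\partial_x^\alpha\partial_y^\beta\,\sigma^+,$$ where $\alpha,\beta\ge0$ are integers with $\alpha+\beta\le\Delta$ (an empty product is $1$). Then: 1. For all integers $0\le\Delta\le n$, the Lie superalgebra $\mathfrak s^\Delta_n$ is finite-dimensional if and only if $\Delta\le1$. 2. For every integer $n\ge1$, $\mathfrak s^1_n$ is isomorphic, as a Lie superalgebra, to $\mathfrak{spl}(3,1)$, the Lie superalgebra of complex $(3+1)\times(3+1)$ matrices of supertrace zero. 3. For every integer $n\ge0$, the Lie algebra obtained from $\mathfrak s^0_n$ by replacing $J$ with $\sigma_3$ and the supercommutator with the ordinary commutator, that is, the Lie algebra generated by $T^1,\dots,T^8,\sigma_3,Q^-_{00},Q^+_{00}$ (for $\Delta=0$), is isomorphic to $\mathfrak{sl}_3\oplus\mathfrak{sl}_2$ (over $\mathbb C$). -/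

import Mathlib

open MvPolynomial

/- The commutator bracket on associative algebras, for the Lie algebra structure of matrices. -/
attribute [local instance] LieRing.ofAssociativeRing

noncomputable section

/-! ### Lie superalgebras over the complex numbers -/

/-- The sign `(-1) ^ (k * l)` for degrees `k, l ∈ ℤ/2`. -/
def superSign (k l : ZMod 2) : ℂ := if k = 1 ∧ l = 1 then -1 else 1

/-- A Lie superalgebra structure on a complex vector space `L`: a decomposition
`L = L₀ ⊕ L₁` and a bilinear bracket that is compatible with the grading, graded
skew-symmetric, and satisfies the graded Jacobi identity. -/
structure LieSuperalgebra (L : Type*) [AddCommGroup L] [Module ℂ L] where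
  /-- `grading 0` is the even part and `grading 1` the odd part. -/
  grading : ZMod 2 → Submodule ℂ L
  isCompl : IsCompl (grading 0) (grading 1)
  bracket : L →ₗ[ℂ] L →ₗ[ℂ] L
  bracket_mem_grading : ∀ k l : ZMod 2, ∀ x ∈ grading k, ∀ y ∈ grading l,
    bracket x y ∈ grading (k + l)
  bracket_skew : ∀ k l : ZMod 2, ∀ x ∈ grading k, ∀ y ∈ grading l,
    bracket x y = -(superSign k l • bracket y x)
  jacobi : ∀ k l m : ZMod 2, ∀ x ∈ grading k, ∀ y ∈ grading l, ∀ z ∈ grading m,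
    bracket x (bracket y z) =
      bracket (bracket x y) z + superSign k l • bracket y (bracket x z)

namespace LieSuperalgebra

variable {L L' : Type*} [AddCommGroup L] [Module ℂ L] [AddCommGroup L'] [Module ℂ L']

/-- An isomorphism of Lie superalgebras: a linear bijection that preserves the parity and the
bracket. -/
structure Iso (A : LieSuperalgebra L) (B : LieSuperalgebra L') extends L ≃ₗ[ℂ] L' where
  map_grading : ∀ k : ZMod 2, ∀ x ∈ A.grading k, toLinearEquiv x ∈ B.grading k
  map_bracket : ∀ x y : L,
    toLinearEquiv (A.bracket x y) = B.bracket (toLinearEquiv x) (toLinearEquiv y)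

/-- A Lie sub-superalgebra: a graded subspace closed under the bracket. Graded means that
the even and the odd component of each of its elements belong to it. -/
structure Sub (A : LieSuperalgebra L) extends Submodule ℂ L where
  graded : ∀ x ∈ A.grading 0, ∀ y ∈ A.grading 1, x + y ∈ toSubmodule →
    x ∈ toSubmodule ∧ y ∈ toSubmodule
  bracket_mem : ∀ x ∈ toSubmodule, ∀ y ∈ toSubmodule, A.bracket x y ∈ toSubmodule

/-- A Lie sub-superalgebra is a Lie superalgebra. -/
def Sub.toLieSuperalgebra {A : LieSuperalgebra L} (S : A.Sub) :
    LieSuperalgebra S.toSubmodule where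
  grading k := (A.grading k).comap S.toSubmodule.subtype
  isCompl := by
    constructor
    · rw [Submodule.disjoint_def]
      intro x h0 h1
      exact Subtype.ext ((Submodule.disjoint_def.1 A.isCompl.disjoint) x.1 h0 h1)
    · rw [codisjoint_iff, eq_top_iff]
      rintro ⟨z, hz⟩ -
      have hz' : z ∈ A.grading 0 ⊔ A.grading 1 := by
        rw [A.isCompl.sup_eq_top]; trivial
      obtain ⟨x, hx, y, hy, rfl⟩ := Submodule.mem_sup.1 hz'
      obtain ⟨hx', hy'⟩ := S.graded x hx y hy hz
      exact Submodule.mem_sup.2 ⟨⟨x, hx'⟩, hx, ⟨y, hy'⟩, hy, rfl⟩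
  bracket := LinearMap.mk₂ ℂ (fun x y => ⟨A.bracket x y, S.bracket_mem x x.2 y y.2⟩)
    (fun _ _ _ => Subtype.ext (by simp)) (fun _ _ _ => Subtype.ext (by simp))
    (fun _ _ _ => Subtype.ext (by simp)) (fun _ _ _ => Subtype.ext (by simp))
  bracket_mem_grading k l x hx y hy := A.bracket_mem_grading k l x hx y hy
  bracket_skew k l x hx y hy := Subtype.ext (A.bracket_skew k l x hx y hy)
  jacobi k l m x hx y hy z hz := Subtype.ext (A.jacobi k l m x hx y hy z hz)

/-- The Lie sub-superalgebra generated by a set: the intersection of all Lie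
sub-superalgebras that contain it. -/
def lieSpan (A : LieSuperalgebra L) (s : Set L) : A.Sub where
  toSubmodule := sInf {N | ∃ S : A.Sub, s ⊆ S.toSubmodule ∧ N = S.toSubmodule}
  graded x hx y hy h := by
    rw [Submodule.mem_sInf] at h
    simp only [Submodule.mem_sInf]
    constructor
    · rintro N ⟨S, hS, rfl⟩
      exact (S.graded x hx y hy (h _ ⟨S, hS, rfl⟩)).1
    · rintro N ⟨S, hS, rfl⟩
      exact (S.graded x hx y hy (h _ ⟨S, hS, rfl⟩)).2
  bracket_mem x hx y hy := by
    rw [Submodule.mem_sInf] at hx hy ⊢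
    rintro N ⟨S, hS, rfl⟩
    exact S.bracket_mem x (hx _ ⟨S, hS, rfl⟩) y (hy _ ⟨S, hS, rfl⟩)

end LieSuperalgebra

/-! ### Matrices with a parity on the index set -/

namespace SuperMatrix

variable {ι R : Type*} [Fintype ι] [DecidableEq ι] [Ring R] [Algebra ℂ R]

/-- Matrices of degree `k`: the entries `M i j` with `par i + par j ≠ k` vanish. -/
def degreePart (R : Type*) [Ring R] [Algebra ℂ R] (par : ι → ZMod 2) (k : ZMod 2) :
    Submodule ℂ (Matrix ι ι R) where
  carrier := {M | ∀ i j, par i + par j ≠ k → M i j = 0}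
  add_mem' ha hb i j h := by simp [ha i j h, hb i j h]
  zero_mem' _ _ _ := rfl
  smul_mem' c M hM i j h := by simp [hM i j h]

/-- The projection onto the matrices of degree `k`. -/
def proj (par : ι → ZMod 2) (k : ZMod 2) : Matrix ι ι R →ₗ[ℂ] Matrix ι ι R where
  toFun M := Matrix.of fun i j => if par i + par j = k then M i j else 0
  map_add' M N := by ext i j; by_cases h : par i + par j = k <;> simp [h]
  map_smul' c M := by ext i j; by_cases h : par i + par j = k <;> simp [h]

/-- The supercommutator, the bilinear extension of
`[M, N] = M N - (-1) ^ (deg M * deg N) N M` for homogeneous `M`, `N`. -/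
def superComm (par : ι → ZMod 2) : Matrix ι ι R →ₗ[ℂ] Matrix ι ι R →ₗ[ℂ] Matrix ι ι R :=
  ∑ k : ZMod 2, ∑ l : ZMod 2, LinearMap.compl₁₂
    (LinearMap.mul ℂ (Matrix ι ι R) - superSign k l • (LinearMap.mul ℂ (Matrix ι ι R)).flip)
    (proj par k) (proj par l)

theorem proj_of_mem (par : ι → ZMod 2) {k : ZMod 2} {M : Matrix ι ι R}
    (hM : M ∈ degreePart R par k) (l : ZMod 2) : proj par l M = if k = l then M else 0 := by
  ext i j
  have := hM i j
  simp only [proj, LinearMap.coe_mk, AddHom.coe_mk, Matrix.of_apply]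
  split_ifs with h1 h2 h2
  · rfl
  · exact this fun h => h2 (h.symm.trans h1)
  · exact (this fun h => h1 (h.trans h2)).symm
  · rfl

theorem superComm_of_mem (par : ι → ZMod 2) {k l : ZMod 2} {M N : Matrix ι ι R}
    (hM : M ∈ degreePart R par k) (hN : N ∈ degreePart R par l) :
    superComm par M N = M * N - superSign k l • (N * M) := by
  simp only [superComm, LinearMap.sum_apply, LinearMap.compl₁₂_apply, proj_of_mem par hM,
    proj_of_mem par hN]
  rw [Finset.sum_eq_single k, Finset.sum_eq_single l]
  · simp
  · intro b _ hb; simp [hb.symm]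
  · simp
  · intro b _ hb; simp [hb.symm]
  · simp

theorem mul_mem (par : ι → ZMod 2) {k l : ZMod 2} {M N : Matrix ι ι R}
    (hM : M ∈ degreePart R par k) (hN : N ∈ degreePart R par l) :
    M * N ∈ degreePart R par (k + l) := by
  intro i j h
  rw [Matrix.mul_apply]
  refine Finset.sum_eq_zero fun a _ => ?_
  by_cases h1 : par i + par a = k
  · by_cases h2 : par a + par j = l
    · refine absurd ?_ h
      rw [← h1, ← h2]
      generalize par i = u
      generalize par a = v
      generalize par j = w
      revert u v w; decide
    · rw [hN a j h2, mul_zero]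
  · rw [hM i a h1, zero_mul]

theorem superComm_mem (par : ι → ZMod 2) {k l : ZMod 2} {M N : Matrix ι ι R}
    (hM : M ∈ degreePart R par k) (hN : N ∈ degreePart R par l) :
    superComm par M N ∈ degreePart R par (k + l) := by
  rw [superComm_of_mem par hM hN]
  exact Submodule.sub_mem _ (mul_mem par hM hN)
    (Submodule.smul_mem _ _ (add_comm l k ▸ mul_mem par hN hM))

/-- The Lie superalgebra of all matrices over `R`, with the supercommutator. -/
def lieSuperalgebra (R : Type*) [Ring R] [Algebra ℂ R] (par : ι → ZMod 2) :
    LieSuperalgebra (Matrix ι ι R) where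
  grading := degreePart R par
  isCompl := by
    constructor
    · rw [Submodule.disjoint_def]
      intro M h0 h1
      ext i j
      by_cases h : par i + par j = 0
      · exact h1 i j (by rw [h]; decide)
      · exact h0 i j h
    · rw [codisjoint_iff, eq_top_iff]
      rintro M -
      refine Submodule.mem_sup.2 ⟨proj par 0 M, ?_, proj par 1 M, ?_, ?_⟩
      · intro i j h; simp [proj, h]
      · intro i j h; simp [proj, h]
      · ext i j
        have h2 : par i + par j = 0 ∨ par i + par j = 1 := by
          generalize par i + par j = u
          revert u; decide
        rcases h2 with h | h <;> simp [proj, h]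
  bracket := superComm par
  bracket_mem_grading k l x hx y hy := superComm_mem par hx hy
  bracket_skew k l x hx y hy := by
    rw [superComm_of_mem par hx hy, superComm_of_mem par hy hx]
    unfold superSign
    by_cases hk : k = 1 <;> by_cases hl : l = 1 <;> simp [hk, hl]
  jacobi k l m x hx y hy z hz := by
    rw [superComm_of_mem par hx (superComm_mem par hy hz), superComm_of_mem par hy hz,
      superComm_of_mem par (superComm_mem par hx hy) hz, superComm_of_mem par hx hy,
      superComm_of_mem par hy (superComm_mem par hx hz), superComm_of_mem par hx hz]
    have h2 : ∀ u : ZMod 2, u = 0 ∨ u = 1 := by decide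
    have h11 : (1 : ZMod 2) + 1 = 0 := by decide
    rcases h2 k with rfl | rfl <;> rcases h2 l with rfl | rfl <;> rcases h2 m with rfl | rfl <;>
      simp [superSign, h11] <;> noncomm_ring

/-- The supertrace `∑ (-1) ^ (par i) * M i i`. -/
def supertrace (par : ι → ZMod 2) (M : Matrix ι ι ℂ) : ℂ :=
  ∑ i, (if par i = 0 then 1 else -1) * M i i

theorem supertrace_superComm (par : ι → ZMod 2) (M N : Matrix ι ι ℂ) :
    supertrace par (superComm par M N) = 0 := by
  have h2 : ∀ u : ZMod 2, u = 0 ∨ u = 1 := by decide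
  have hu : (Finset.univ : Finset (ZMod 2)) = {0, 1} := by decide
  have h01 : ((0 : ZMod 2) = 1) = False := by simp
  have h11 : (1 : ZMod 2) + 1 = 0 := by decide
  have key : ∀ i, (superComm par M N) i i =
      ∑ j, (M i j * N j i - (if par i + par j = 0 then 1 else -1) * (N i j * M j i)) := by
    intro i
    simp only [superComm, hu, superSign]
    simp [proj, Matrix.mul_apply, Matrix.add_apply, Matrix.sub_apply]
    simp only [← Finset.sum_add_distrib, ← Finset.sum_sub_distrib]
    refine Finset.sum_congr rfl fun j _ => ?_
    rcases h2 (par i) with h | h <;> rcases h2 (par j) with h' | h' <;> simp [h, h', h11]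
  unfold supertrace
  simp only [key, Finset.mul_sum, mul_sub, Finset.sum_sub_distrib]
  rw [sub_eq_zero, Finset.sum_comm]
  refine Finset.sum_congr rfl fun i _ => Finset.sum_congr rfl fun j _ => ?_
  rcases h2 (par i) with h | h <;> rcases h2 (par j) with h' | h' <;> simp [h, h', h11] <;> ring

end SuperMatrix

/-- The parity on the index set of `(p + q) × (p + q)` matrices: the first `p` indices are
even, the last `q` are odd. -/
def blockParity (p q : ℕ) : Fin p ⊕ Fin q → ZMod 2 := Sum.elim (fun _ => 0) (fun _ => 1)

/-- The special linear Lie superalgebra `spl(p, q)`: complex `(p + q) × (p + q)` matrices of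
supertrace zero, with the supercommutator. -/
def spl (p q : ℕ) : (SuperMatrix.lieSuperalgebra ℂ (blockParity p q)).Sub where
  carrier := {M | SuperMatrix.supertrace (blockParity p q) M = 0}
  add_mem' {a b} ha hb := by
    simp only [Set.mem_ofPred_eq, SuperMatrix.supertrace, Matrix.add_apply, mul_add,
      Finset.sum_add_distrib] at *
    rw [ha, hb, add_zero]
  zero_mem' := by simp [SuperMatrix.supertrace]
  smul_mem' c M hM := by
    simp only [Set.mem_ofPred_eq, SuperMatrix.supertrace, Matrix.smul_apply, smul_eq_mul] at *
    simp only [mul_left_comm _ c]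
    rw [← Finset.mul_sum, hM, mul_zero]
  graded x hx y hy h := by
    have hy' : ∀ i, y i i = 0 := fun i => hy i i (by
      generalize blockParity p q i = u
      revert u; decide)
    have hy0 : SuperMatrix.supertrace (blockParity p q) y = 0 := by
      simp [SuperMatrix.supertrace, hy']
    refine ⟨?_, hy0⟩
    change SuperMatrix.supertrace (blockParity p q) (x + y) = 0 at h
    change SuperMatrix.supertrace (blockParity p q) x = 0
    simpa [SuperMatrix.supertrace, hy'] using h
  bracket_mem x _ y _ := SuperMatrix.supertrace_superComm _ x y

/-! ### Differential operators in two variables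

A differential operator with polynomial coefficients in `x, y` is identified with the
endomorphism of `ℂ[x, y]` it induces; this identification is injective. A `2 × 2` matrix
differential operator acts on `ℂ[x, y] ⊕ ℂ[x, y]`. -/

/-- The endomorphisms of `ℂ[x, y]`. -/
abbrev PolyEnd : Type := Module.End ℂ (MvPolynomial (Fin 2) ℂ)

namespace PolyEnd

/-- Multiplication by `x`. -/
def x : PolyEnd := LinearMap.mulLeft ℂ (X 0)

/-- Multiplication by `y`. -/
def y : PolyEnd := LinearMap.mulLeft ℂ (X 1)

/-- The partial derivative `∂/∂x`. -/
def dx : PolyEnd := (pderiv (R := ℂ) (0 : Fin 2)).toLinearMap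

/-- The partial derivative `∂/∂y`. -/
def dy : PolyEnd := (pderiv (R := ℂ) (1 : Fin 2)).toLinearMap

/-- The operators `J¹, …, J⁸` with parameter `c` (listed here as `J c 0, …, J c 7`), a basis of a
copy of `sl₃`. -/
def J (c : ℂ) : Fin 8 → PolyEnd :=
  ![x ^ 2 * dx + x * y * dy - c • x,
    x * y * dx + y ^ 2 * dy - c • y,
    y * dx,
    dx,
    dy,
    x * dy,
    x * dx - (c / 3) • 1,
    y * dy - (c / 3) • 1]

/-- The multiplication operator `q_{αβ} = x^α y^β`. -/
def q (α β : ℕ) : PolyEnd := x ^ α * y ^ β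

/-- The operator `∏_{k=1}^{Δ-α-β} (x ∂x + y ∂y - n + Δ - k) ∂x^α ∂y^β`. The factors of the
product commute. -/
def qbar (n Δ α β : ℕ) : PolyEnd :=
  ((List.range (Δ - α - β)).map fun k =>
    x * dx + y * dy - ((n : ℂ) - (Δ : ℂ) + ((k : ℂ) + 1)) • (1 : PolyEnd)).prod *
  (dx ^ α * dy ^ β)

end PolyEnd

/-- `2 × 2` matrices of operators on `ℂ[x, y]`. -/
abbrev MatOp : Type := Matrix (Fin 2) (Fin 2) PolyEnd

/-- The Lie superalgebra of `2 × 2` matrices of operators: diagonal matrices are even,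
off-diagonal ones odd. -/
def matOpSuper : LieSuperalgebra MatOp := SuperMatrix.lieSuperalgebra PolyEnd ![0, 1]

namespace Triangular

/-- `T^i = diag(J^i_{n-Δ}, J^i_n)`. -/
def T (n Δ : ℕ) (i : Fin 8) : MatOp :=
  !![PolyEnd.J ((n : ℂ) - (Δ : ℂ)) i, 0; 0, PolyEnd.J (n : ℂ) i]

/-- `J = (1/3) diag(n + 2Δ, n)`. -/
def J (n Δ : ℕ) : MatOp :=
  !![(((n : ℂ) + 2 * (Δ : ℂ)) / 3) • (1 : PolyEnd), 0; 0, ((n : ℂ) / 3) • (1 : PolyEnd)]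

/-- `Q⁻_{αβ} = q_{αβ} σ⁻`. -/
def Qminus (α β : ℕ) : MatOp := !![0, 0; PolyEnd.q α β, 0]

/-- `Q⁺_{αβ} = q̄_{αβ}(n, Δ) σ⁺`. -/
def Qplus (n Δ α β : ℕ) : MatOp := !![0, PolyEnd.qbar n Δ α β; 0, 0]

/-- `σ₃ = diag(1, -1)`. -/
def sigma3 : MatOp := !![1, 0; 0, -1]

/-- The generators `T^i`, `J`, `Q^±_{αβ}`, `0 ≤ α + β ≤ Δ`. -/
def generators (n Δ : ℕ) : Set MatOp :=
  Set.range (T n Δ) ∪ {J n Δ} ∪ {M | ∃ α β : ℕ, α + β ≤ Δ ∧ M = Qminus α β} ∪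
    {M | ∃ α β : ℕ, α + β ≤ Δ ∧ M = Qplus n Δ α β}

/-- The Lie superalgebra `s^Δ_n` generated by `T^i`, `J`, `Q^±_{αβ}`. -/
def s (n Δ : ℕ) : matOpSuper.Sub := matOpSuper.lieSpan (generators n Δ)

/-- `s^0_n` regarded as a Lie algebra with `J` replaced by `σ₃`: the Lie algebra, under the
ordinary commutator, generated by `T^i`, `σ₃`, `Q^±_{00}` for `Δ = 0`. -/
def sZeroLie (n : ℕ) : LieSubalgebra ℂ MatOp :=
  LieSubalgebra.lieSpan ℂ MatOp
    (Set.range (T n 0) ∪ {sigma3, Qminus 0 0, Qplus n 0 0 0})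

end Triangular

end

/-!
In homogeneous coordinates `z₀, z₁, z₂` on the plane, `gl₃` acts on functions homogeneous of degree
`c` by the vector fields `zᵢ ∂/∂zⱼ`; in the chart `z₀ = 1` its trace zero part acts by the operators
`J¹, …, J⁸`. A matrix in the kernel has every point `(1, s, t)` as an eigenvector, so it is scalar.

Adding an odd coordinate gives an action of `gl(3 | 1)`, faithful for `n ≠ 0`, under which
`spl(3, 1)` is spanned by preimages of the generators for `Δ = 1`. For `Δ = 0` the generators lie
in the image of `gl₃ ⊕ gl₂`, where `gl₂` acts by constant `2 × 2` matrices.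

For `Δ ≥ 2`, the bracket of `Q⁺_{Δ0}` with `Q⁻_{00}` is `∂x^Δ · 1`, and bracketing `∂x^m · 1` with
`[Q⁺_{Δ0}, Q⁻_{10}] = diag(∂x^Δ x, x ∂x^Δ)` gives `m ∂x^(m + Δ - 1) · 1`. The powers of `∂x` are
linearly independent: if `p(∂x) = 0`, then `p'(∂x) = [p(∂x), x] = 0`.
-/

noncomputable section

/-! ### Homomorphisms of Lie superalgebras -/

namespace LieSuperalgebra

variable {L L' : Type*} [AddCommGroup L] [Module ℂ L] [AddCommGroup L'] [Module ℂ L']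
  {A : LieSuperalgebra L} {B : LieSuperalgebra L'}

theorem isCompl_grading (A : LieSuperalgebra L) (k : ZMod 2) :
    IsCompl (A.grading k) (A.grading (k + 1)) := by
  fin_cases k
  · exact A.isCompl
  · exact A.isCompl.symm

theorem exists_eq_add (A : LieSuperalgebra L) (x : L) :
    ∃ x₀ ∈ A.grading 0, ∃ x₁ ∈ A.grading 1, x₀ + x₁ = x :=
  Submodule.mem_sup.1 (A.isCompl.sup_eq_top ▸ Submodule.mem_top)

theorem add_inj_of_mem_grading (A : LieSuperalgebra L) {x x' y y' : L} (hx : x ∈ A.grading 0)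
    (hx' : x' ∈ A.grading 0) (hy : y ∈ A.grading 1) (hy' : y' ∈ A.grading 1)
    (h : x + y = x' + y') : x = x' ∧ y = y' := by
  have hsub : x - x' = y' - y := by rw [sub_eq_sub_iff_add_eq_add, h, add_comm]
  have hzero : x - x' = 0 := Submodule.disjoint_def.1 A.isCompl.disjoint _
    (Submodule.sub_mem _ hx hx') (hsub ▸ Submodule.sub_mem _ hy' hy)
  exact ⟨sub_eq_zero.1 hzero, (sub_eq_zero.1 (hsub.symm.trans hzero)).symm⟩

theorem subset_lieSpan (A : LieSuperalgebra L) (s : Set L) : s ⊆ (A.lieSpan s).toSubmodule := by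
  intro x hx
  refine Submodule.mem_sInf.2 ?_
  rintro _ ⟨S, hS, rfl⟩
  exact hS hx

theorem lieSpan_le {s : Set L} {S : A.Sub} (h : s ⊆ S.toSubmodule) :
    (A.lieSpan s).toSubmodule ≤ S.toSubmodule :=
  sInf_le ⟨S, h, rfl⟩

theorem lieSpan_eq_of_span_eq {s : Set L} {S : A.Sub} (h : Submodule.span ℂ s = S.toSubmodule) :
    (A.lieSpan s).toSubmodule = S.toSubmodule :=
  le_antisymm (lieSpan_le (h ▸ Submodule.subset_span))
    (h ▸ Submodule.span_le.2 (A.subset_lieSpan s))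

/-- A homomorphism of Lie superalgebras: an even linear map that preserves the bracket. -/
structure Hom (A : LieSuperalgebra L) (B : LieSuperalgebra L') extends L →ₗ[ℂ] L' where
  map_grading : ∀ k : ZMod 2, ∀ x ∈ A.grading k, toLinearMap x ∈ B.grading k
  map_bracket : ∀ x y : L,
    toLinearMap (A.bracket x y) = B.bracket (toLinearMap x) (toLinearMap y)

/-- A homomorphism of Lie superalgebras, from an even linear map that preserves the bracket of
homogeneous elements. -/
def Hom.ofHomogeneous (f : L →ₗ[ℂ] L') (hf : ∀ k, ∀ x ∈ A.grading k, f x ∈ B.grading k)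
    (h : ∀ k l, ∀ x ∈ A.grading k, ∀ y ∈ A.grading l,
      f (A.bracket x y) = B.bracket (f x) (f y)) : Hom A B where
  toLinearMap := f
  map_grading := hf
  map_bracket x y := by
    obtain ⟨x₀, hx₀, x₁, hx₁, rfl⟩ := A.exists_eq_add x
    obtain ⟨y₀, hy₀, y₁, hy₁, rfl⟩ := A.exists_eq_add y
    simp only [map_add, LinearMap.add_apply, h 0 0 x₀ hx₀ y₀ hy₀, h 0 1 x₀ hx₀ y₁ hy₁,
      h 1 0 x₁ hx₁ y₀ hy₀, h 1 1 x₁ hx₁ y₁ hy₁]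

theorem Hom.mem_grading_of_injective (f : Hom A B) (hf : Function.Injective f.toLinearMap)
    {k : ZMod 2} {x : L} (hx : f.toLinearMap x ∈ B.grading k) : x ∈ A.grading k := by
  obtain ⟨u, hu, v, hv, rfl⟩ : ∃ u ∈ A.grading k, ∃ v ∈ A.grading (k + 1), u + v = x :=
    Submodule.mem_sup.1 ((A.isCompl_grading k).sup_eq_top ▸ Submodule.mem_top)
  have hfv : f.toLinearMap v ∈ B.grading k := by
    simpa using Submodule.sub_mem _ hx (f.map_grading k u hu)
  have hfv0 : f.toLinearMap v = 0 :=
    Submodule.disjoint_def.1 (B.isCompl_grading k).disjoint _ hfv (f.map_grading (k + 1) v hv)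
  rw [map_eq_zero_iff _ hf] at hfv0
  rwa [hfv0, add_zero]

/-- The image of a Lie sub-superalgebra under a homomorphism. -/
def Sub.map (S : A.Sub) (f : Hom A B) : B.Sub where
  toSubmodule := S.toSubmodule.map f.toLinearMap
  graded := by
    rintro x hx y hy ⟨z, hz, hfz⟩
    obtain ⟨z₀, hz₀, z₁, hz₁, rfl⟩ := A.exists_eq_add z
    obtain ⟨hz₀S, hz₁S⟩ := S.graded z₀ hz₀ z₁ hz₁ hz
    rw [map_add] at hfz
    obtain ⟨rfl, rfl⟩ := B.add_inj_of_mem_grading (f.map_grading 0 z₀ hz₀) hx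
      (f.map_grading 1 z₁ hz₁) hy hfz
    exact ⟨⟨z₀, hz₀S, rfl⟩, ⟨z₁, hz₁S, rfl⟩⟩
  bracket_mem := by
    rintro _ ⟨x, hx, rfl⟩ _ ⟨y, hy, rfl⟩
    exact ⟨A.bracket x y, S.bracket_mem x hx y hy, f.map_bracket x y⟩

/-- The isomorphism onto a Lie sub-superalgebra `S` from the image of `S` under an injective
homomorphism. The image is given up to equality, as a Lie sub-superalgebra `T`. -/
def Sub.isoOfMapEq {S : A.Sub} {T : B.Sub} (f : Hom A B) (hf : Function.Injective f.toLinearMap)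
    (h : S.toSubmodule.map f.toLinearMap = T.toSubmodule) :
    Iso T.toLieSuperalgebra S.toLieSuperalgebra :=
  let e := (Submodule.equivMapOfInjective f.toLinearMap hf S.toSubmodule).trans
    (LinearEquiv.ofEq _ _ h)
  have he (x : T.toSubmodule) : f.toLinearMap (e.symm x) = x :=
    congrArg Subtype.val (e.apply_symm_apply x)
  { e.symm with
    map_grading := fun _ x hx =>
      f.mem_grading_of_injective hf (((he x).symm ▸ hx : _ ∈ B.grading _))
    map_bracket := fun x y => Subtype.ext <| hf <| by
      change f.toLinearMap (e.symm _) = f.toLinearMap (A.bracket (e.symm x) (e.symm y))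
      rw [f.map_bracket, he, he, he]
      rfl }

end LieSuperalgebra

/-! ### Vector fields with linear coefficients -/

theorem superSign_comm (k l : ZMod 2) : superSign k l = superSign l k := by
  simp only [superSign, and_comm]

theorem superSign_add_left (k l m : ZMod 2) :
    superSign (k + l) m = superSign k m * superSign l m := by
  have h11 : (1 : ZMod 2) + 1 = 0 := by decide
  have h2 : ∀ u : ZMod 2, u = 0 ∨ u = 1 := by decide
  rcases h2 k with rfl | rfl <;> rcases h2 l with rfl | rfl <;> rcases h2 m with rfl | rfl <;>
    simp [superSign, h11]

theorem superSign_add_right (k l m : ZMod 2) :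
    superSign k (l + m) = superSign k l * superSign k m := by
  rw [superSign_comm, superSign_add_left, superSign_comm l, superSign_comm m]

theorem superSign_mul_self (k l : ZMod 2) : superSign k l * superSign k l = 1 := by
  unfold superSign
  split_ifs <;> norm_num

theorem superSign_zero_left (l : ZMod 2) : superSign 0 l = 1 := by
  simp [superSign]

namespace SuperMatrix

variable {ι R : Type*} [DecidableEq ι] [Ring R] [Algebra ℂ R] {par : ι → ZMod 2}

theorem single_mem_degreePart (i j : ι) (r : R) :
    Matrix.single i j r ∈ degreePart R par (par i + par j) := by
  intro a b hab
  rw [Matrix.single_apply, if_neg]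
  rintro ⟨rfl, rfl⟩
  exact hab rfl

theorem degreePart_eq_span_single [Finite ι] (k : ZMod 2) :
    degreePart ℂ par k =
      Submodule.span ℂ {M | ∃ i j, par i + par j = k ∧ M = Matrix.single i j 1} := by
  have := Fintype.ofFinite ι
  refine le_antisymm (fun M hM => ?_) (Submodule.span_le.2 ?_)
  · rw [Matrix.matrix_eq_sum_single M]
    refine Submodule.sum_mem _ fun i _ => Submodule.sum_mem _ fun j _ => ?_
    by_cases h : par i + par j = k
    · rw [← mul_one (M i j), ← smul_eq_mul, ← Matrix.smul_single]
      exact Submodule.smul_mem _ _ (Submodule.subset_span ⟨i, j, h, rfl⟩)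
    · rw [hM i j h, Matrix.single_zero]
      exact Submodule.zero_mem _
  · rintro _ ⟨i, j, rfl, rfl⟩
    exact single_mem_degreePart i j 1

theorem superComm_single [Fintype ι] (i j k l : ι) :
    superComm par (Matrix.single i j (1 : R)) (Matrix.single k l 1) =
      (if j = k then Matrix.single i l 1 else 0) -
        superSign (par i + par j) (par k + par l) •
          (if l = i then Matrix.single k j 1 else 0) := by
  rw [superComm_of_mem par (single_mem_degreePart i j 1) (single_mem_degreePart k l 1)]
  congr 2
  · split_ifs with h
    · rw [h, Matrix.single_mul_single_same, one_mul]
    · rw [Matrix.single_mul_single_of_ne _ _ _ _ h]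
  · split_ifs with h
    · rw [h, Matrix.single_mul_single_same, one_mul]
    · rw [Matrix.single_mul_single_of_ne _ _ _ _ h]

end SuperMatrix

/-- A `ℤ/2`-graded analogue of coordinates `zᵢ` and derivations `∂ᵢ` acting on homogeneous
functions, with the graded canonical commutation relations. The operators `deriv c i` represent
`∂ᵢ` on functions homogeneous of degree `c`, so that `deriv c i` lowers the degree to `c - 1`;
dehomogenized functions do not remember their degree, hence the extra argument. -/
structure WeylSystem {ι : Type*} [DecidableEq ι] (par : ι → ZMod 2) (R : Type*) [Ring R]
    [Algebra ℂ R] where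
  coord : ι → R
  deriv : ℂ → ι → R
  coord_mul_coord : ∀ i j,
    coord i * coord j = superSign (par i) (par j) • (coord j * coord i)
  deriv_mul_deriv : ∀ c i j, deriv (c - 1) i * deriv c j =
    superSign (par i) (par j) • (deriv (c - 1) j * deriv c i)
  deriv_mul_coord : ∀ c i j, deriv c i * coord j =
    superSign (par i) (par j) • (coord j * deriv (c - 1) i) + if i = j then 1 else 0

namespace WeylSystem

open SuperMatrix

variable {ι R : Type*} [DecidableEq ι] [Ring R] [Algebra ℂ R] {par : ι → ZMod 2}

theorem coord_mul_deriv_mul (W : WeylSystem par R) (c : ℂ) (i j k l : ι) :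
    W.coord i * W.deriv c j * (W.coord k * W.deriv c l) =
      superSign (par j) (par k) •
        (W.coord i * W.coord k * (W.deriv (c - 1) j * W.deriv c l)) +
        if j = k then W.coord i * W.deriv c l else 0 := by
  calc _ = W.coord i * (W.deriv c j * W.coord k) * W.deriv c l := by noncomm_ring
    _ = _ := by
      rw [W.deriv_mul_coord, mul_add, add_mul, mul_smul_comm, smul_mul_assoc]
      split_ifs <;> simp only [mul_one, mul_zero, zero_mul, mul_assoc]

variable [Fintype ι]

/-- The action of `gl(ι)` by the linear vector fields `zᵢ ∂ⱼ`. -/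
def rep (W : WeylSystem par R) (c : ℂ) : Matrix ι ι ℂ →ₗ[ℂ] R :=
  Matrix.liftLinear ℂ fun i j => LinearMap.toSpanSingleton ℂ R (W.coord i * W.deriv c j)

theorem rep_apply (W : WeylSystem par R) (c : ℂ) (M : Matrix ι ι ℂ) :
    W.rep c M = ∑ i, ∑ j, M i j • (W.coord i * W.deriv c j) := by
  simp [rep, Matrix.liftLinear_apply]

theorem rep_single (W : WeylSystem par R) (c : ℂ) (i j : ι) :
    W.rep c (Matrix.single i j 1) = W.coord i * W.deriv c j := by
  simp [rep, Matrix.liftLinear_single]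

theorem rep_superComm_single (W : WeylSystem par R) (c : ℂ) (i j k l : ι) :
    W.rep c (superComm par (Matrix.single i j 1) (Matrix.single k l 1)) =
      W.coord i * W.deriv c j * (W.coord k * W.deriv c l) -
        superSign (par i + par j) (par k + par l) •
          (W.coord k * W.deriv c l * (W.coord i * W.deriv c j)) := by
  have hsign : superSign (par i + par j) (par k + par l) * (superSign (par l) (par i) *
      (superSign (par l) (par j) * superSign (par k) (par i))) = superSign (par j) (par k) := by
    rw [superSign_comm (par l) (par i), superSign_comm (par k) (par i),
      superSign_comm (par l) (par j)]
    simp only [superSign_add_left, superSign_add_right]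
    linear_combination superSign (par j) (par k) *
      (superSign (par i) (par l) ^ 2 * superSign (par j) (par l) ^ 2 *
          superSign_mul_self (par i) (par k) +
        superSign (par j) (par l) ^ 2 * superSign_mul_self (par i) (par l) +
        superSign_mul_self (par j) (par l))
  rw [superComm_single, map_sub, map_smul, coord_mul_deriv_mul, coord_mul_deriv_mul,
    W.coord_mul_coord k i, W.deriv_mul_deriv c l j]
  simp only [apply_ite (W.rep c), rep_single, map_zero, smul_add, smul_mul_assoc, mul_smul_comm,
    smul_smul, mul_assoc, hsign]
  abel

theorem rep_superComm_of_mem (W : WeylSystem par R) (c : ℂ) {k l : ZMod 2} {M N : Matrix ι ι ℂ}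
    (hM : M ∈ degreePart ℂ par k) (hN : N ∈ degreePart ℂ par l) :
    W.rep c (superComm par M N) =
      W.rep c M * W.rep c N - superSign k l • (W.rep c N * W.rep c M) := by
  rw [degreePart_eq_span_single] at hM hN
  induction hM, hN using Submodule.span_induction₂ with
  | mem_mem x y hx hy =>
    obtain ⟨i, j, rfl, rfl⟩ := hx
    obtain ⟨i', j', rfl, rfl⟩ := hy
    simp only [rep_superComm_single, rep_single]
  | zero_left => simp
  | zero_right => simp
  | add_left x y z _ _ _ hxz hyz =>
    simp only [map_add, LinearMap.add_apply, hxz, hyz, add_mul, mul_add, smul_add]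
    abel
  | add_right x y z _ _ _ hxy hxz =>
    simp only [map_add, hxy, hxz, add_mul, mul_add, smul_add]
    abel
  | smul_left r x y _ _ hxy =>
    simp only [map_smul, LinearMap.smul_apply, hxy, smul_sub, smul_mul_assoc, mul_smul_comm,
      smul_comm r]
  | smul_right r x y _ _ hxy =>
    simp only [map_smul, hxy, smul_sub, smul_mul_assoc, mul_smul_comm, smul_comm r]

theorem linearIndependent_coord [Nonempty ι] (W : WeylSystem par R) {c : ℂ}
    (h : Function.Injective (W.rep c)) : LinearIndependent ℂ W.coord := by
  refine Fintype.linearIndependent_iff.2 fun a ha i => ?_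
  let j := Classical.arbitrary ι
  have hrep : W.rep c (∑ i, a i • Matrix.single i j 1) = 0 := by
    simp only [map_sum, map_smul, rep_single, ← smul_mul_assoc, ← Finset.sum_mul, ha, zero_mul]
  simpa [Matrix.sum_apply, Matrix.single_apply] using
    congrFun (congrFun ((map_eq_zero_iff _ h).1 hrep) i) j

theorem linearIndependent_deriv [Nonempty ι] (W : WeylSystem par R) {c : ℂ}
    (h : Function.Injective (W.rep c)) : LinearIndependent ℂ (W.deriv c) := by
  refine Fintype.linearIndependent_iff.2 fun a ha j => ?_
  let i := Classical.arbitrary ι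
  have hrep : W.rep c (∑ j, a j • Matrix.single i j 1) = 0 := by
    simp only [map_sum, map_smul, rep_single, ← mul_smul_comm, ← Finset.mul_sum, ha, mul_zero]
  simpa [Matrix.sum_apply, Matrix.single_apply] using
    congrFun (congrFun ((map_eq_zero_iff _ h).1 hrep) i) j

/-- The action of the general linear Lie superalgebra by the vector fields `zᵢ ∂ⱼ`, when `R` is a
matrix algebra whose grading is compatible with the parities of the coordinates. -/
def superRep {κ : Type*} [Fintype κ] [DecidableEq κ] {par' : κ → ZMod 2}
    (W : WeylSystem par (Matrix κ κ R)) (c : ℂ)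
    (hcoord : ∀ i, W.coord i ∈ degreePart R par' (par i))
    (hderiv : ∀ i, W.deriv c i ∈ degreePart R par' (par i)) :
    LieSuperalgebra.Hom (lieSuperalgebra ℂ par) (lieSuperalgebra R par') :=
  have hrep (k : ZMod 2) (M : Matrix ι ι ℂ) (hM : M ∈ degreePart ℂ par k) :
      W.rep c M ∈ degreePart R par' k := by
    rw [rep_apply]
    refine Submodule.sum_mem _ fun i _ => Submodule.sum_mem _ fun j _ => ?_
    by_cases h : par i + par j = k
    · exact Submodule.smul_mem _ _ (h ▸ mul_mem par' (hcoord i) (hderiv j))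
    · rw [hM i j h, zero_smul]
      exact Submodule.zero_mem _
  .ofHomogeneous (W.rep c) hrep fun k l M hM N hN =>
    (W.rep_superComm_of_mem c hM hN).trans
      (superComm_of_mem par' (hrep k M hM) (hrep l N hN)).symm

section Even

variable {ι R : Type*} [DecidableEq ι] [Ring R] [Algebra ℂ R]

theorem coord_mul_coord_comm (W : WeylSystem (0 : ι → ZMod 2) R) (i j : ι) :
    W.coord i * W.coord j = W.coord j * W.coord i := by
  simpa [superSign_zero_left] using W.coord_mul_coord i j

theorem deriv_mul_deriv_comm (W : WeylSystem (0 : ι → ZMod 2) R) (c : ℂ) (i j : ι) :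
    W.deriv (c - 1) i * W.deriv c j = W.deriv (c - 1) j * W.deriv c i := by
  simpa [superSign_zero_left] using W.deriv_mul_deriv c i j

theorem deriv_mul_coord_comm (W : WeylSystem (0 : ι → ZMod 2) R) (c : ℂ) (i j : ι) :
    W.deriv c i * W.coord j = W.coord j * W.deriv (c - 1) i + if i = j then 1 else 0 := by
  simpa [superSign_zero_left] using W.deriv_mul_coord c i j

/-- The representation `WeylSystem.rep` of the Lie algebra `gl(ι)`, for even coordinates. -/
def lieRep [Fintype ι] (W : WeylSystem (0 : ι → ZMod 2) R) (c : ℂ) :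
    Matrix ι ι ℂ →ₗ⁅ℂ⁆ R :=
  { W.rep c with
    map_lie' := fun {M N} => by
      have hdeg (A : Matrix ι ι ℂ) : A ∈ SuperMatrix.degreePart ℂ (0 : ι → ZMod 2) 0 :=
        fun i j h => absurd (add_zero 0) h
      have h := W.rep_superComm_of_mem c (hdeg M) (hdeg N)
      rw [SuperMatrix.superComm_of_mem _ (hdeg M) (hdeg N), superSign_zero_left, one_smul,
        one_smul] at h
      exact h }

theorem lieRep_apply [Fintype ι] (W : WeylSystem (0 : ι → ZMod 2) R) (c : ℂ)
    (A : Matrix ι ι ℂ) : W.lieRep c A = W.rep c A := rfl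

theorem rep_mul_coord [Fintype ι] (W : WeylSystem (0 : ι → ZMod 2) R) (c : ℂ)
    (A : Matrix ι ι ℂ) (k : ι) :
    W.rep c A * W.coord k = W.coord k * W.rep (c - 1) A + ∑ i, A i k • W.coord i := by
  have hterm (i j : ι) : W.coord i * W.deriv c j * W.coord k =
      W.coord k * (W.coord i * W.deriv (c - 1) j) + if j = k then W.coord i else 0 := by
    rw [mul_assoc, deriv_mul_coord_comm, mul_add, ← mul_assoc, ← mul_assoc,
      W.coord_mul_coord_comm i k, mul_ite, mul_one, mul_zero]
  simp only [rep_apply, Finset.sum_mul, Finset.mul_sum, smul_mul_assoc, hterm, smul_add,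
    mul_smul_comm, Finset.sum_add_distrib, smul_ite, smul_zero, Finset.sum_ite_eq',
    Finset.mem_univ, if_true]

end Even

section Superize

variable {p : ℕ} {R : Type*} [Ring R] [Algebra ℂ R]

/-- One odd coordinate `θ` added to `p` even ones. A function `f + θ g` homogeneous of degree `c`
is a column with entries `g`, homogeneous of degree `c - 1`, and `f`, homogeneous of degree `c`;
so `θ` and `∂/∂θ` become the matrix units `σ⁺` and `σ⁻`. -/
def superize (W : WeylSystem (0 : Fin p → ZMod 2) R) :
    WeylSystem (blockParity p 1) (Matrix (Fin 2) (Fin 2) R) where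
  coord := Sum.elim (fun i => !![W.coord i, 0; 0, W.coord i]) fun _ => !![0, 1; 0, 0]
  deriv c := Sum.elim (fun i => !![W.deriv (c - 1) i, 0; 0, W.deriv c i])
    fun _ => !![0, 0; 1, 0]
  coord_mul_coord := by
    rintro (i | i) (j | j)
    · simp [blockParity, superSign, W.coord_mul_coord_comm i j]
    all_goals ext a b; fin_cases a <;> fin_cases b <;> simp [blockParity, superSign]
  deriv_mul_deriv := by
    rintro c (i | i) (j | j)
    · simp [blockParity, superSign, W.deriv_mul_deriv_comm _ i j]
    all_goals ext a b; fin_cases a <;> fin_cases b <;> simp [blockParity, superSign]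
  deriv_mul_coord := by
    rintro c (i | i) (j | j)
    · rcases eq_or_ne i j with rfl | hij
      · simp [blockParity, superSign, deriv_mul_coord_comm, Matrix.one_fin_two]
      · simp [blockParity, superSign, deriv_mul_coord_comm, hij]
    · ext a b; fin_cases a <;> fin_cases b <;> simp [blockParity, superSign]
    · ext a b; fin_cases a <;> fin_cases b <;> simp [blockParity, superSign]
    · obtain rfl := Subsingleton.elim i j
      ext a b; fin_cases a <;> fin_cases b <;> simp [blockParity, superSign]

theorem rep_superize (W : WeylSystem (0 : Fin p → ZMod 2) R) (c : ℂ)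
    (M : Matrix (Fin p ⊕ Fin 1) (Fin p ⊕ Fin 1) ℂ) :
    W.superize.rep c M =
      !![W.rep (c - 1) M.toBlocks₁₁ + M (.inr 0) (.inr 0) • 1,
          ∑ j, M (.inr 0) (.inl j) • W.deriv c j;
        ∑ i, M (.inl i) (.inr 0) • W.coord i, W.rep c M.toBlocks₁₁] := by
  ext a b
  fin_cases a <;> fin_cases b <;>
    simp [rep_apply, superize, Matrix.sum_apply, Matrix.toBlocks₁₁]

/-- The action of `gl(p | 1)` on functions of `p` even coordinates and one odd coordinate. -/
def superizeRep (W : WeylSystem (0 : Fin p → ZMod 2) R) (c : ℂ) :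
    LieSuperalgebra.Hom (SuperMatrix.lieSuperalgebra ℂ (blockParity p 1))
      (SuperMatrix.lieSuperalgebra R ![0, 1]) :=
  W.superize.superRep c
    (by rintro (i | i) a b <;> fin_cases a <;> fin_cases b <;>
          simp [superize, blockParity, CharTwo.add_self_eq_zero])
    (by rintro (i | i) a b <;> fin_cases a <;> fin_cases b <;>
          simp [superize, blockParity, CharTwo.add_self_eq_zero])

theorem superizeRep_apply (W : WeylSystem (0 : Fin p → ZMod 2) R) (c : ℂ)
    (M : Matrix (Fin p ⊕ Fin 1) (Fin p ⊕ Fin 1) ℂ) :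
    (W.superizeRep c).toLinearMap M = W.superize.rep c M := rfl

theorem superizeRep_injective [NeZero p] (W : WeylSystem (0 : Fin p → ZMod 2) R) {c : ℂ}
    (hrep : Function.Injective (W.rep c)) :
    Function.Injective (W.superizeRep c).toLinearMap := by
  have : Nontrivial R := hrep.nontrivial
  refine (injective_iff_map_eq_zero _).2 fun M hM => ?_
  rw [superizeRep_apply, rep_superize] at hM
  have hentry (a b : Fin 2) := congrFun (congrFun hM a) b
  have h₁₁ : M.toBlocks₁₁ = 0 :=
    (map_eq_zero_iff _ hrep).1 (by simpa using hentry 1 1)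
  have h₂₂ : M (.inr 0) (.inr 0) = 0 := by
    simpa [h₁₁] using hentry 0 0
  have h₁₂ : ∀ i, M (.inl i) (.inr 0) = 0 :=
    Fintype.linearIndependent_iff.1 (W.linearIndependent_coord hrep) _ (by simpa using hentry 1 0)
  have h₂₁ : ∀ j, M (.inr 0) (.inl j) = 0 :=
    Fintype.linearIndependent_iff.1 (W.linearIndependent_deriv hrep) _ (by simpa using hentry 0 1)
  ext (i | i) (j | j)
  · exact congrFun (congrFun h₁₁ i) j
  · rw [Subsingleton.elim j 0]; exact h₁₂ i
  · rw [Subsingleton.elim i 0]; exact h₂₁ j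
  · rw [Subsingleton.elim i 0, Subsingleton.elim j 0]; exact h₂₂

end Superize

end WeylSystem

/-! ### The projective plane -/

namespace PolyEnd

theorem y_mul_x : y * x = x * y :=
  LinearMap.ext fun p => by simp [x, y, mul_left_comm]

theorem dx_mul_x : dx * x = x * dx + 1 :=
  LinearMap.ext fun p => by simp [dx, x, Derivation.leibniz, add_comm]

theorem dy_mul_y : dy * y = y * dy + 1 :=
  LinearMap.ext fun p => by simp [dy, y, Derivation.leibniz, add_comm]

theorem dx_mul_y : dx * y = y * dx :=
  LinearMap.ext fun p => by simp [dx, y, Derivation.leibniz]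

theorem dy_mul_x : dy * x = x * dy :=
  LinearMap.ext fun p => by simp [dy, x, Derivation.leibniz]

theorem dy_mul_dx : dy * dx = dx * dy := by
  have h : ⁅pderiv (R := ℂ) (1 : Fin 2), pderiv (R := ℂ) (0 : Fin 2)⁆ = 0 :=
    MvPolynomial.derivation_ext fun i => by
      rw [Derivation.commutator_apply]
      fin_cases i <;> simp
  refine LinearMap.ext fun p => sub_eq_zero.1 ?_
  have hp := Derivation.congr_fun h p
  rwa [Derivation.commutator_apply] at hp

/-- The Euler operator `x ∂/∂x + y ∂/∂y`. -/
def euler : PolyEnd := x * dx + y * dy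

theorem euler_mul_x : euler * x = x * euler + x := by
  rw [euler, add_mul, mul_assoc, dx_mul_x, mul_assoc, dy_mul_x, ← mul_assoc y, y_mul_x]
  noncomm_ring

theorem euler_mul_y : euler * y = y * euler + y := by
  rw [euler, add_mul, mul_assoc, dx_mul_y, mul_assoc, dy_mul_y, ← mul_assoc x, ← y_mul_x]
  noncomm_ring

theorem dx_mul_euler : dx * euler = euler * dx + dx := by
  rw [euler, mul_add, ← mul_assoc, dx_mul_x, ← mul_assoc, dx_mul_y, mul_assoc, ← dy_mul_dx]
  noncomm_ring

theorem dy_mul_euler : dy * euler = euler * dy + dy := by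
  rw [euler, mul_add, ← mul_assoc, dy_mul_x, ← mul_assoc, dy_mul_y, mul_assoc, dy_mul_dx]
  noncomm_ring

/-- The homogeneous coordinates `z₀, z₁, z₂` of the projective plane and their partial
derivatives, in the chart `z₀ = 1`. There `∂/∂z₀` acts on functions homogeneous of degree `c` as
`c - x ∂/∂x - y ∂/∂y`, by Euler's identity. -/
def planeSystem : WeylSystem (0 : Fin 3 → ZMod 2) PolyEnd where
  coord := ![1, x, y]
  deriv c := ![c • 1 - euler, dx, dy]
  coord_mul_coord i j := by
    rw [Pi.zero_apply, superSign_zero_left, one_smul]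
    fin_cases i <;> fin_cases j <;> simp [y_mul_x]
  deriv_mul_deriv c i j := by
    rw [Pi.zero_apply, superSign_zero_left, one_smul]
    fin_cases i <;> fin_cases j <;>
      simp [mul_sub, sub_mul, dx_mul_euler, dy_mul_euler, dy_mul_dx, sub_smul]
    all_goals abel
  deriv_mul_coord c i j := by
    rw [Pi.zero_apply, superSign_zero_left, one_smul]
    fin_cases i <;> fin_cases j <;>
      simp [dx_mul_x, dx_mul_y, dy_mul_x, dy_mul_y, mul_sub, sub_mul, euler_mul_x, euler_mul_y,
        sub_smul]
    all_goals abel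

theorem planeSystem_coord : planeSystem.coord = ![1, x, y] := rfl

theorem planeSystem_deriv (c : ℂ) : planeSystem.deriv c = ![c • 1 - euler, dx, dy] := rfl

theorem planeSystem_rep_one (c : ℂ) : planeSystem.rep c 1 = c • 1 := by
  simp [WeylSystem.rep_apply, planeSystem, Fin.sum_univ_three, Matrix.one_apply, euler, add_assoc]

theorem planeSystem_rep_sub_one_add (c : ℂ) (A : Matrix (Fin 3) (Fin 3) ℂ) :
    planeSystem.rep (c - 1) A + ∑ i, A i 0 • planeSystem.coord i = planeSystem.rep c A := by
  have hderiv (j : Fin 3) : planeSystem.deriv c j =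
      planeSystem.deriv (c - 1) j + if j = 0 then 1 else 0 := by
    fin_cases j
    · simp only [planeSystem_deriv, Fin.zero_eta, Matrix.cons_val_zero, if_true]
      module
    all_goals simp [planeSystem_deriv]
  simp only [WeylSystem.rep_apply, hderiv, mul_add, smul_add, Finset.sum_add_distrib, mul_ite,
    mul_one, mul_zero, smul_ite, smul_zero, Finset.sum_ite_eq', Finset.mem_univ, if_true]

/-- The point of `ℂ³` with affine coordinates `(s, t)` in the chart `z₀ = 1`. -/
def affinePoint (s t : ℂ) : Fin 3 → ℂ := ![1, s, t]

theorem eq_smul_one_of_vecMul_affinePoint {A : Matrix (Fin 3) (Fin 3) ℂ}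
    (h : ∀ s t, ∃ μ : ℂ, Matrix.vecMul (affinePoint s t) A = μ • affinePoint s t) :
    A = A 0 0 • 1 := by
  have hval (s t : ℂ) (k : Fin 3) : A 0 k + s * A 1 k + t * A 2 k =
      (A 0 0 + s * A 1 0 + t * A 2 0) * affinePoint s t k := by
    obtain ⟨μ, hμ⟩ := h s t
    have hk (k : Fin 3) : A 0 k + s * A 1 k + t * A 2 k = μ * affinePoint s t k := by
      simpa [Matrix.vecMul, dotProduct, Fin.sum_univ_three, affinePoint] using congrFun hμ k
    rw [hk k, hk 0]
    simp [affinePoint]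
  have h₁ (s t : ℂ) : A 0 1 + s * A 1 1 + t * A 2 1 = (A 0 0 + s * A 1 0 + t * A 2 0) * s :=
    hval s t 1
  have h₂ (s t : ℂ) : A 0 2 + s * A 1 2 + t * A 2 2 = (A 0 0 + s * A 1 0 + t * A 2 0) * t :=
    hval s t 2
  ext i j
  fin_cases i <;> fin_cases j <;> simp
  · linear_combination h₁ 0 0
  · linear_combination h₂ 0 0
  · linear_combination h₁ 0 0 - (h₁ 1 0 + h₁ (-1) 0) / 2
  · linear_combination (h₁ 1 0 - h₁ (-1) 0) / 2
  · linear_combination h₂ 1 0 - h₂ 0 0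
  · linear_combination h₂ 0 0 - (h₂ 0 1 + h₂ 0 (-1)) / 2
  · linear_combination h₁ 0 1 - h₁ 0 0
  · linear_combination (h₂ 0 1 - h₂ 0 (-1)) / 2

theorem coord_mul_sum_of_planeSystem_rep_eq_zero {c : ℂ} {A : Matrix (Fin 3) (Fin 3) ℂ}
    (h : planeSystem.rep c A = 0) (k : Fin 3) :
    planeSystem.coord k * ∑ i, A i 0 • planeSystem.coord i =
      ∑ i, A i k • planeSystem.coord i := by
  have hmul := planeSystem.rep_mul_coord c A k
  have hsub := planeSystem_rep_sub_one_add c A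
  rw [h] at hmul hsub
  calc _ = planeSystem.coord k * ∑ i, A i 0 • planeSystem.coord i +
        (planeSystem.coord k * planeSystem.rep (c - 1) A +
          ∑ i, A i k • planeSystem.coord i) := by rw [← hmul, zero_mul, add_zero]
    _ = planeSystem.coord k *
          (planeSystem.rep (c - 1) A + ∑ i, A i 0 • planeSystem.coord i) +
        ∑ i, A i k • planeSystem.coord i := by rw [mul_add]; abel
    _ = _ := by rw [hsub, mul_zero, zero_add]

theorem eq_smul_one_of_planeSystem_rep_eq_zero {c : ℂ} {A : Matrix (Fin 3) (Fin 3) ℂ}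
    (h : planeSystem.rep c A = 0) : A = A 0 0 • 1 := by
  refine eq_smul_one_of_vecMul_affinePoint fun s t => ⟨∑ i, A i 0 * affinePoint s t i, ?_⟩
  ext k
  have hk := congrArg (fun f : PolyEnd => eval ![s, t] (f 1))
    (coord_mul_sum_of_planeSystem_rep_eq_zero h k)
  simp only [Fin.sum_univ_three, planeSystem_coord] at hk
  fin_cases k
  · simp [Fin.sum_univ_three, Matrix.vecMul, dotProduct, affinePoint, mul_comm]
  all_goals
    simpa [Fin.sum_univ_three, Matrix.vecMul, dotProduct, affinePoint, x, y, mul_comm] using hk.symm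

theorem planeSystem_rep_injective {c : ℂ} (hc : c ≠ 0) :
    Function.Injective (planeSystem.rep c) := by
  refine (injective_iff_map_eq_zero _).2 fun A hA => ?_
  have hscalar := eq_smul_one_of_planeSystem_rep_eq_zero hA
  rw [hscalar, map_smul, planeSystem_rep_one, smul_smul] at hA
  have h₀₀ : A 0 0 = 0 := by simpa [hc] using hA
  rw [hscalar, h₀₀, zero_smul]

theorem eq_zero_of_planeSystem_rep_eq_zero_of_trace_eq_zero {c : ℂ}
    {A : Matrix (Fin 3) (Fin 3) ℂ} (h : planeSystem.rep c A = 0) (htrace : A.trace = 0) :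
    A = 0 := by
  have hscalar := eq_smul_one_of_planeSystem_rep_eq_zero h
  have h₀₀ : A 0 0 = 0 := by
    rw [hscalar] at htrace
    simpa using htrace
  rw [hscalar, h₀₀, zero_smul]

/-- The basis of `sl₃` that acts by the operators `J¹, …, J⁸`. -/
def slBasis : Fin 8 → Matrix (Fin 3) (Fin 3) ℂ :=
  ![-Matrix.single 1 0 1, -Matrix.single 2 0 1, Matrix.single 2 1 1, Matrix.single 0 1 1,
    Matrix.single 0 2 1, Matrix.single 1 2 1, Matrix.single 1 1 1 - (1 / 3 : ℂ) • 1,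
    Matrix.single 2 2 1 - (1 / 3 : ℂ) • 1]

theorem trace_slBasis (i : Fin 8) : (slBasis i).trace = 0 := by
  fin_cases i <;> simp [slBasis]

theorem planeSystem_rep_slBasis (c : ℂ) (i : Fin 8) :
    planeSystem.rep c (slBasis i) = J c i := by
  have hxy : x * (y * dy) = x * y * dy := (mul_assoc _ _ _).symm
  have hyx : y * (x * dx) = x * y * dx := by rw [← mul_assoc, y_mul_x]
  have hxx : x * (x * dx) = x ^ 2 * dx := by rw [← mul_assoc, sq]
  have hyy : y * (y * dy) = y ^ 2 * dy := by rw [← mul_assoc, sq]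
  fin_cases i <;>
    simp [slBasis, J, WeylSystem.rep_single, planeSystem_rep_one, planeSystem_coord,
      planeSystem_deriv, euler, mul_sub, mul_add, hxy, hyx, hxx, hyy, smul_smul, div_eq_inv_mul]

theorem sub_trace_smul_one_mem_span_slBasis (A : Matrix (Fin 3) (Fin 3) ℂ) :
    A - (A.trace / 3) • 1 ∈ Submodule.span ℂ (Set.range slBasis) := by
  have hsum : A - (A.trace / 3) • 1 = ∑ i, ![-A 1 0, -A 2 0, A 2 1, A 0 1, A 0 2, A 1 2,
      A 1 1 - A 0 0, A 2 2 - A 0 0] i • slBasis i := by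
    ext i j
    fin_cases i <;> fin_cases j <;>
      simp [slBasis, Fin.sum_univ_succ, Matrix.trace] <;>
      ring
  rw [hsum]
  exact Submodule.sum_mem _ fun i _ =>
    Submodule.smul_mem _ _ (Submodule.subset_span ⟨i, rfl⟩)

end PolyEnd

/-! ### The case `Δ = 1` -/

namespace Triangular

open PolyEnd

theorem setOf_add_le_zero {α : Type*} (f : ℕ → ℕ → α) :
    {a | ∃ k l : ℕ, k + l ≤ 0 ∧ a = f k l} = {f 0 0} := by
  ext a
  constructor
  · rintro ⟨k, l, hkl, rfl⟩
    obtain ⟨rfl, rfl⟩ : k = 0 ∧ l = 0 := by omega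
    rfl
  · rintro rfl
    exact ⟨0, 0, le_rfl, rfl⟩

theorem setOf_add_le_one {α : Type*} (f : ℕ → ℕ → α) :
    {a | ∃ k l : ℕ, k + l ≤ 1 ∧ a = f k l} = Set.range ![f 0 0, f 1 0, f 0 1] := by
  ext a
  constructor
  · rintro ⟨k, l, hkl, rfl⟩
    obtain ⟨rfl, rfl⟩ | ⟨rfl, rfl⟩ | ⟨rfl, rfl⟩ :
        (k = 0 ∧ l = 0) ∨ (k = 1 ∧ l = 0) ∨ (k = 0 ∧ l = 1) := by omega
    exacts [⟨0, rfl⟩, ⟨1, rfl⟩, ⟨2, rfl⟩]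
  · rintro ⟨i, rfl⟩
    fin_cases i
    exacts [⟨0, 0, zero_le_one, rfl⟩, ⟨1, 0, le_rfl, rfl⟩, ⟨0, 1, le_rfl, rfl⟩]

/-- The elements of `spl(3, 1)` that act as the generators of `s n 1`. -/
def splGenerators : Set (Matrix (Fin 3 ⊕ Fin 1) (Fin 3 ⊕ Fin 1) ℂ) :=
  Set.range (fun i => Matrix.fromBlocks (slBasis i) 0 0 0) ∪
    {Matrix.fromBlocks ((1 / 3 : ℂ) • 1) 0 0 1} ∪
    Set.range (fun i => Matrix.fromBlocks 0 (Matrix.single i 0 1) 0 0) ∪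
    Set.range (fun j => Matrix.fromBlocks 0 0 (Matrix.single 0 j (![-1, 1, 1] j)) 0)

theorem supertrace_blockParity_one {p : ℕ} (M : Matrix (Fin p ⊕ Fin 1) (Fin p ⊕ Fin 1) ℂ) :
    SuperMatrix.supertrace (blockParity p 1) M =
      M.toBlocks₁₁.trace - M (.inr 0) (.inr 0) := by
  simp [SuperMatrix.supertrace, blockParity, Matrix.trace, Matrix.toBlocks₁₁, sub_eq_add_neg]

theorem mem_spl_iff {M : Matrix (Fin 3 ⊕ Fin 1) (Fin 3 ⊕ Fin 1) ℂ} :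
    M ∈ (spl 3 1).toSubmodule ↔ M.toBlocks₁₁.trace = M (.inr 0) (.inr 0) := by
  rw [← sub_eq_zero, ← supertrace_blockParity_one]
  rfl

theorem splGenerators_subset_spl : splGenerators ⊆ (spl 3 1).toSubmodule := by
  rintro _ (((⟨i, rfl⟩ | rfl) | ⟨i, rfl⟩) | ⟨j, rfl⟩)
  all_goals simp [mem_spl_iff, trace_slBasis]

theorem fromBlocks_mem_span_splGenerators {A : Matrix (Fin 3) (Fin 3) ℂ}
    (hA : A ∈ Submodule.span ℂ (Set.range slBasis)) :
    Matrix.fromBlocks A 0 0 (0 : Matrix (Fin 1) (Fin 1) ℂ) ∈ Submodule.span ℂ splGenerators := by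
  induction hA using Submodule.span_induction with
  | mem A hA =>
    obtain ⟨i, rfl⟩ := hA
    exact Submodule.subset_span (.inl (.inl (.inl ⟨i, rfl⟩)))
  | zero => simp
  | add A A' _ _ h h' => simpa [Matrix.fromBlocks_add] using Submodule.add_mem _ h h'
  | smul c A _ h => simpa [Matrix.fromBlocks_smul] using Submodule.smul_mem _ c h

theorem span_splGenerators : Submodule.span ℂ splGenerators = (spl 3 1).toSubmodule := by
  refine le_antisymm (Submodule.span_le.2 splGenerators_subset_spl) fun M hM => ?_
  have htrace := mem_spl_iff.1 hM
  have hM' : M = Matrix.fromBlocks (M.toBlocks₁₁ - (M.toBlocks₁₁.trace / 3) • 1) 0 0 0 +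
      M (.inr 0) (.inr 0) • Matrix.fromBlocks ((1 / 3 : ℂ) • 1) 0 0 1 +
      ∑ i, M (.inl i) (.inr 0) • Matrix.fromBlocks 0 (Matrix.single i 0 1) 0 0 +
      ∑ j, (![-1, 1, 1] j * M (.inr 0) (.inl j)) •
        Matrix.fromBlocks 0 0 (Matrix.single 0 j (![-1, 1, 1] j)) 0 := by
    ext (i | i) (j | j)
    · rw [htrace]
      simp [Matrix.sum_apply, Matrix.toBlocks₁₁]
      ring
    · simp [Matrix.sum_apply, Subsingleton.elim j 0, Matrix.single_apply]
    · simp only [Subsingleton.elim i 0]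
      fin_cases j <;> simp [Fin.sum_univ_three]
    · simp [Matrix.sum_apply, Subsingleton.elim i 0, Subsingleton.elim j 0]
  rw [hM']
  refine add_mem (add_mem (add_mem ?_ ?_) (sum_mem fun i _ => ?_)) (sum_mem fun j _ => ?_)
  · exact fromBlocks_mem_span_splGenerators (sub_trace_smul_one_mem_span_slBasis _)
  · exact Submodule.smul_mem _ _ (Submodule.subset_span (.inl (.inl (.inr rfl))))
  · exact Submodule.smul_mem _ _ (Submodule.subset_span (.inl (.inr ⟨i, rfl⟩)))
  · exact Submodule.smul_mem _ _ (Submodule.subset_span (.inr ⟨j, rfl⟩))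

/-- The action of `gl(3 | 1)` on functions, homogeneous of degree `n`, of three even coordinates
and an odd one. -/
def planeSuperRep (n : ℕ) :
    LieSuperalgebra.Hom (SuperMatrix.lieSuperalgebra ℂ (blockParity 3 1)) matOpSuper :=
  planeSystem.superizeRep n

theorem planeSuperRep_apply (n : ℕ) (M : Matrix (Fin 3 ⊕ Fin 1) (Fin 3 ⊕ Fin 1) ℂ) :
    (planeSuperRep n).toLinearMap M =
      !![planeSystem.rep (n - 1) M.toBlocks₁₁ + M (.inr 0) (.inr 0) • 1,
          ∑ j, M (.inr 0) (.inl j) • planeSystem.deriv n j;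
        ∑ i, M (.inl i) (.inr 0) • planeSystem.coord i, planeSystem.rep n M.toBlocks₁₁] :=
  planeSystem.rep_superize n M

theorem planeSuperRep_injective {n : ℕ} (hn : n ≠ 0) :
    Function.Injective (planeSuperRep n).toLinearMap :=
  planeSystem.superizeRep_injective (planeSystem_rep_injective (Nat.cast_ne_zero.2 hn))

theorem planeSuperRep_slBasis (n : ℕ) (i : Fin 8) :
    (planeSuperRep n).toLinearMap (Matrix.fromBlocks (slBasis i) 0 0 0) = T n 1 i := by
  simp [planeSuperRep_apply, planeSystem_rep_slBasis, T]

theorem planeSuperRep_one_third (n : ℕ) :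
    (planeSuperRep n).toLinearMap (Matrix.fromBlocks ((1 / 3 : ℂ) • 1) 0 0 1) = J n 1 := by
  have h : (3⁻¹ * ((n : ℂ) - 1)) • (1 : PolyEnd) + 1 = (3⁻¹ * ((n : ℂ) + 2)) • 1 := by
    module
  simp [planeSuperRep_apply, planeSystem_rep_one, J, h, smul_smul, div_eq_inv_mul]

theorem planeSuperRep_upper (n : ℕ) (i : Fin 3) :
    (planeSuperRep n).toLinearMap (Matrix.fromBlocks 0 (Matrix.single i 0 1) 0 0) =
      ![Qminus 0 0, Qminus 1 0, Qminus 0 1] i := by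
  rw [planeSuperRep_apply]
  fin_cases i <;> simp [Fin.sum_univ_three, planeSystem_coord, Qminus, q]

theorem planeSuperRep_lower (n : ℕ) (j : Fin 3) :
    (planeSuperRep n).toLinearMap
        (Matrix.fromBlocks 0 0 (Matrix.single 0 j (![-1, 1, 1] j)) 0) =
      ![Qplus n 1 0 0, Qplus n 1 1 0, Qplus n 1 0 1] j := by
  have h : (-1 : ℂ) • ((n : ℂ) • 1 - (x * dx + y * dy)) =
      x * dx + y * dy - (n : ℂ) • 1 := by
    module
  rw [planeSuperRep_apply]
  fin_cases j <;>
    simp [Fin.sum_univ_three, planeSystem_deriv, Qplus, qbar, euler, h]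

theorem image_splGenerators (n : ℕ) :
    (planeSuperRep n).toLinearMap '' splGenerators = generators n 1 := by
  rw [generators, setOf_add_le_one, setOf_add_le_one]
  simp only [splGenerators, Set.image_union, Set.image_singleton, ← Set.range_comp,
    Function.comp_def, planeSuperRep_slBasis, planeSuperRep_one_third, planeSuperRep_upper,
    planeSuperRep_lower]

theorem map_planeSuperRep_spl (n : ℕ) :
    (spl 3 1).toSubmodule.map (planeSuperRep n).toLinearMap = (s n 1).toSubmodule := by
  refine (LieSuperalgebra.lieSpan_eq_of_span_eq (S := (spl 3 1).map (planeSuperRep n)) ?_).symm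
  rw [← image_splGenerators, Submodule.span_image, span_splGenerators]
  rfl

theorem finiteDimensional_s_one (n : ℕ) : FiniteDimensional ℂ (s n 1).toSubmodule := by
  rw [← map_planeSuperRep_spl]
  infer_instance

theorem nonempty_iso_spl {n : ℕ} (hn : 1 ≤ n) :
    Nonempty ((s n 1).toLieSuperalgebra.Iso (spl 3 1).toLieSuperalgebra) :=
  ⟨LieSuperalgebra.Sub.isoOfMapEq (planeSuperRep n) (planeSuperRep_injective (by omega))
    (map_planeSuperRep_spl n)⟩

end Triangular

/-! ### The case `Δ = 0` -/

section TensorRep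

open SuperMatrix

variable {𝔤 κ R : Type*} [LieRing 𝔤] [LieAlgebra ℂ 𝔤] [Fintype κ] [DecidableEq κ] [Ring R]
  [Algebra ℂ R]

theorem commute_scalar_map_algebraMap (r : R) (B : Matrix κ κ ℂ) :
    Commute (Matrix.scalar κ r) (B.map (algebraMap ℂ R)) := by
  ext i j
  rw [Matrix.scalar_apply, Matrix.diagonal_mul, Matrix.mul_diagonal, Matrix.map_apply,
    Algebra.commutes]

/-- The action of `𝔤 × gl(κ)` on `V ⊗ ℂ^κ`, for operators `f` on `V` that represent `𝔤`. -/
def tensorRep (κ : Type*) [Fintype κ] [DecidableEq κ] (f : 𝔤 →ₗ⁅ℂ⁆ R) :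
    𝔤 × Matrix κ κ ℂ →ₗ⁅ℂ⁆ Matrix κ κ R :=
  { ((Matrix.scalarAlgHom κ ℂ).toLinearMap ∘ₗ f.toLinearMap).coprod
      (Algebra.ofId ℂ R).mapMatrix.toLinearMap with
    map_lie' := fun {p q} => by
      have h₁ := (commute_scalar_map_algebraMap (f p.1) q.2).eq
      have h₂ := (commute_scalar_map_algebraMap (f q.1) p.2).eq
      change Matrix.scalar κ (f ⁅p.1, q.1⁆) + (Algebra.ofId ℂ R).mapMatrix ⁅p.2, q.2⁆ =
        ⁅Matrix.scalar κ (f p.1) + p.2.map (algebraMap ℂ R),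
          Matrix.scalar κ (f q.1) + q.2.map (algebraMap ℂ R)⁆
      simp only [LieHom.map_lie, Ring.lie_def, map_sub, map_mul, mul_add, add_mul, h₁, h₂]
      change _ + (p.2.map (algebraMap ℂ R) * q.2.map (algebraMap ℂ R) -
        q.2.map (algebraMap ℂ R) * p.2.map (algebraMap ℂ R)) = _
      abel }

theorem tensorRep_apply (f : 𝔤 →ₗ⁅ℂ⁆ R) (A : 𝔤) (B : Matrix κ κ ℂ) :
    tensorRep κ f (A, B) = Matrix.scalar κ (f A) + B.map (algebraMap ℂ R) := rfl

theorem tensorRep_add (f : 𝔤 →ₗ⁅ℂ⁆ R) (A : 𝔤) (B B' : Matrix κ κ ℂ) :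
    tensorRep κ f (A, B + B') = tensorRep κ f (A, B) + tensorRep κ f (0, B') := by
  rw [← map_add, Prod.mk_add_mk, add_zero]

theorem tensorRep_mem_degreePart_zero (f : 𝔤 →ₗ⁅ℂ⁆ R) (A : 𝔤) {par : κ → ZMod 2}
    {B : Matrix κ κ ℂ} (hB : B ∈ degreePart ℂ par 0) :
    tensorRep κ f (A, B) ∈ degreePart R par 0 := by
  intro i j hij
  have hne : i ≠ j := fun h => hij (h ▸ CharTwo.add_self_eq_zero _)
  simp [tensorRep_apply, hB i j hij, hne]

theorem tensorRep_zero_mem_degreePart (f : 𝔤 →ₗ⁅ℂ⁆ R) {par : κ → ZMod 2} {k : ZMod 2}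
    {B : Matrix κ κ ℂ} (hB : B ∈ degreePart ℂ par k) :
    tensorRep κ f (0, B) ∈ degreePart R par k := by
  intro i j hij
  simp [tensorRep_apply, hB i j hij]

theorem superComm_tensorRep_zero (f : 𝔤 →ₗ⁅ℂ⁆ R) {par : κ → ZMod 2} {k l : ZMod 2}
    {B B' : Matrix κ κ ℂ} (hB : B ∈ degreePart ℂ par k) (hB' : B' ∈ degreePart ℂ par l) :
    superComm par (tensorRep κ f (0, B)) (tensorRep κ f (0, B')) =
      tensorRep κ f (0, superComm par B B') := by
  have hmap (C : Matrix κ κ ℂ) : tensorRep κ f (0, C) = (Algebra.ofId ℂ R).mapMatrix C := by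
    rw [tensorRep_apply, map_zero, map_zero, zero_add]
    rfl
  rw [superComm_of_mem par (tensorRep_zero_mem_degreePart f hB)
    (tensorRep_zero_mem_degreePart f hB'), superComm_of_mem par hB hB']
  simp only [hmap, map_sub, map_smul, map_mul]

theorem SuperMatrix.superComm_eq_lie_of_superSign_eq_one {par : κ → ZMod 2} {k l : ZMod 2}
    {M N : Matrix κ κ R} (hM : M ∈ degreePart R par k) (hN : N ∈ degreePart R par l)
    (h : superSign k l = 1) : superComm par M N = ⁅M, N⁆ := by
  rw [superComm_of_mem par hM hN, h, one_smul, Ring.lie_def]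

/-- The range of `tensorRep`, as a Lie sub-superalgebra. -/
def tensorRepRange (f : 𝔤 →ₗ⁅ℂ⁆ R) (par : κ → ZMod 2) : (lieSuperalgebra R par).Sub where
  toSubmodule := (tensorRep κ f : 𝔤 × Matrix κ κ ℂ →ₗ[ℂ] Matrix κ κ R).range
  graded := by
    rintro M hM N hN ⟨⟨A, B⟩, h⟩
    obtain ⟨B₀, hB₀, B₁, hB₁, rfl⟩ := (lieSuperalgebra ℂ par).exists_eq_add B
    obtain ⟨rfl, rfl⟩ := (lieSuperalgebra R par).add_inj_of_mem_grading
      (tensorRep_mem_degreePart_zero f A hB₀) hM (tensorRep_zero_mem_degreePart f hB₁) hN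
      ((tensorRep_add f A B₀ B₁).symm.trans h)
    exact ⟨⟨_, rfl⟩, ⟨_, rfl⟩⟩
  bracket_mem := by
    rintro _ ⟨⟨A, B⟩, rfl⟩ _ ⟨⟨A', B'⟩, rfl⟩
    obtain ⟨B₀, hB₀, B₁, hB₁, rfl⟩ := (lieSuperalgebra ℂ par).exists_eq_add B
    obtain ⟨B₀', hB₀', B₁', hB₁', rfl⟩ := (lieSuperalgebra ℂ par).exists_eq_add B'
    have h₀ := tensorRep_mem_degreePart_zero f A hB₀
    have h₁ := tensorRep_zero_mem_degreePart f hB₁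
    have h₀' := tensorRep_mem_degreePart_zero f A' hB₀'
    have h₁' := tensorRep_zero_mem_degreePart f hB₁'
    change superComm par (tensorRep κ f _) (tensorRep κ f _) ∈ _
    simp only [tensorRep_add, map_add, LinearMap.add_apply]
    rw [superComm_eq_lie_of_superSign_eq_one h₀ h₀' (by simp [superSign]),
      superComm_eq_lie_of_superSign_eq_one h₀ h₁' (by simp [superSign]),
      superComm_eq_lie_of_superSign_eq_one h₁ h₀' (by simp [superSign]),
      superComm_tensorRep_zero f hB₁ hB₁']
    simp only [← LieHom.map_lie]
    exact add_mem (add_mem ⟨_, rfl⟩ ⟨_, rfl⟩) (add_mem ⟨_, rfl⟩ ⟨_, rfl⟩)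

theorem eq_zero_of_tensorRep_eq_zero [Nonempty κ] [Nontrivial R] {f : 𝔤 →ₗ⁅ℂ⁆ R} {A : 𝔤}
    {B : Matrix κ κ ℂ} (h : tensorRep κ f (A, B) = 0) (htrace : B.trace = 0) :
    f A = 0 ∧ B = 0 := by
  have hentry (i j : κ) : (if i = j then f A else 0) + algebraMap ℂ R (B i j) = 0 := by
    simpa [tensorRep_apply, Matrix.diagonal_apply] using congrFun (congrFun h i) j
  have hdiag (i : κ) : f A + algebraMap ℂ R (B i i) = 0 := by simpa using hentry i i
  have hoff (i j : κ) (hij : i ≠ j) : B i j = 0 := by simpa [hij] using hentry i j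
  have hA : f A = 0 := by
    have htrace' : ∑ i, algebraMap ℂ R (B i i) = 0 := by
      rw [← map_sum]
      exact (congrArg _ htrace).trans (map_zero _)
    have hsum : Fintype.card κ • f A = 0 := by
      calc Fintype.card κ • f A = ∑ i : κ, (f A + algebraMap ℂ R (B i i)) := by
            simp [Finset.sum_add_distrib, htrace']
        _ = 0 := by simp [hdiag]
    rw [← Nat.cast_smul_eq_nsmul ℂ] at hsum
    simpa using hsum
  refine ⟨hA, ?_⟩
  ext i j
  rcases eq_or_ne i j with rfl | hij
  · simpa [hA] using hdiag i
  · exact hoff i j hij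

end TensorRep

namespace Triangular

open PolyEnd LieAlgebra.SpecialLinear

/-- The action of `gl₃ ⊕ gl₂` on pairs of functions homogeneous of degree `n`. -/
def planeTensorRep (n : ℕ) :
    Matrix (Fin 3) (Fin 3) ℂ × Matrix (Fin 2) (Fin 2) ℂ →ₗ⁅ℂ⁆ MatOp :=
  tensorRep (Fin 2) (planeSystem.lieRep n)

theorem planeTensorRep_apply (n : ℕ) (A : Matrix (Fin 3) (Fin 3) ℂ)
    (B : Matrix (Fin 2) (Fin 2) ℂ) :
    planeTensorRep n (A, B) =
      !![planeSystem.rep n A + B 0 0 • 1, B 0 1 • 1;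
        B 1 0 • 1, planeSystem.rep n A + B 1 1 • 1] := by
  rw [planeTensorRep, tensorRep_apply, WeylSystem.lieRep_apply]
  ext i j
  fin_cases i <;> fin_cases j <;> simp [Algebra.algebraMap_eq_smul_one]

theorem planeTensorRep_slBasis (n : ℕ) (i : Fin 8) :
    planeTensorRep n (slBasis i, 0) = T n 0 i := by
  simp [planeTensorRep_apply, planeSystem_rep_slBasis, T]

theorem planeTensorRep_smul_one (n : ℕ) :
    planeTensorRep n (0, ((n : ℂ) / 3) • 1) = J n 0 := by
  simp [planeTensorRep_apply, J]

theorem planeTensorRep_diagonal (n : ℕ) :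
    planeTensorRep n (0, Matrix.diagonal ![1, -1]) = sigma3 := by
  have h : (-1 : ℂ) • (1 : PolyEnd) = -1 := by module
  simp [planeTensorRep_apply, sigma3, h]

theorem planeTensorRep_single_one_zero (n : ℕ) :
    planeTensorRep n (0, Matrix.single 1 0 1) = Qminus 0 0 := by
  simp [planeTensorRep_apply, Qminus, q]

theorem planeTensorRep_single_zero_one (n : ℕ) :
    planeTensorRep n (0, Matrix.single 0 1 1) = Qplus n 0 0 0 := by
  simp [planeTensorRep_apply, Qplus, qbar]

theorem finiteDimensional_s_zero (n : ℕ) : FiniteDimensional ℂ (s n 0).toSubmodule := by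
  have hgen : generators n 0 ⊆
      (tensorRepRange (planeSystem.lieRep n) (![0, 1] : Fin 2 → ZMod 2)).toSubmodule := by
    rw [generators, setOf_add_le_zero, setOf_add_le_zero]
    rintro _ (((⟨i, rfl⟩ | rfl) | rfl) | rfl)
    exacts [⟨_, planeTensorRep_slBasis n i⟩, ⟨_, planeTensorRep_smul_one n⟩,
      ⟨_, planeTensorRep_single_one_zero n⟩, ⟨_, planeTensorRep_single_zero_one n⟩]
  have : FiniteDimensional ℂ
      (tensorRepRange (planeSystem.lieRep n) (![0, 1] : Fin 2 → ZMod 2)).toSubmodule := by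
    unfold tensorRepRange
    infer_instance
  exact Submodule.finiteDimensional_of_le (LieSuperalgebra.lieSpan_le hgen)

/-- The action of `sl₃ ⊕ sl₂` on pairs of functions homogeneous of degree `n`. -/
def planeSlRep (n : ℕ) : sl (Fin 3) ℂ × sl (Fin 2) ℂ →ₗ⁅ℂ⁆ MatOp :=
  (planeTensorRep n).comp ((sl (Fin 3) ℂ).incl.prodMap (sl (Fin 2) ℂ).incl)

theorem planeSlRep_injective (n : ℕ) : Function.Injective (planeSlRep n) := by
  refine (injective_iff_map_eq_zero _).2 ?_
  rintro ⟨⟨A, hA⟩, ⟨B, hB⟩⟩ h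
  obtain ⟨hrep, rfl⟩ := eq_zero_of_tensorRep_eq_zero (f := planeSystem.lieRep n) h hB
  obtain rfl := eq_zero_of_planeSystem_rep_eq_zero_of_trace_eq_zero hrep hA
  rfl

theorem planeTensorRep_left_mem_sZeroLie (n : ℕ) {A : Matrix (Fin 3) (Fin 3) ℂ}
    (hA : A.trace = 0) : planeTensorRep n (A, 0) ∈ sZeroLie n := by
  have hspan : A ∈ Submodule.span ℂ (Set.range slBasis) := by
    simpa [hA] using sub_trace_smul_one_mem_span_slBasis A
  have hle : Submodule.span ℂ (Set.range slBasis) ≤ (sZeroLie n).toSubmodule.comap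
      ((planeTensorRep n).toLinearMap ∘ₗ LinearMap.inl ℂ _ _) := by
    rw [Submodule.span_le]
    rintro _ ⟨i, rfl⟩
    exact LieSubalgebra.subset_lieSpan (.inl ⟨i, (planeTensorRep_slBasis n i).symm⟩)
  exact hle hspan

theorem planeTensorRep_right_mem_sZeroLie (n : ℕ) {B : Matrix (Fin 2) (Fin 2) ℂ}
    (hB : B.trace = 0) : planeTensorRep n (0, B) ∈ sZeroLie n := by
  have hB' : B = B 0 0 • Matrix.diagonal ![1, -1] + B 1 0 • Matrix.single 1 0 1 +
      B 0 1 • Matrix.single 0 1 1 := by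
    rw [Matrix.trace_fin_two, add_eq_zero_iff_neg_eq] at hB
    ext i j
    fin_cases i <;> fin_cases j <;> simp [hB]
  have hsum : planeTensorRep n (0, B) =
      B 0 0 • sigma3 + B 1 0 • Qminus 0 0 + B 0 1 • Qplus n 0 0 0 := by
    rw [← planeTensorRep_diagonal n, ← planeTensorRep_single_one_zero n,
      ← planeTensorRep_single_zero_one n]
    simp only [← map_smul, ← map_add, Prod.smul_mk, Prod.mk_add_mk, smul_zero, add_zero, ← hB']
  have hgen : {sigma3, Qminus 0 0, Qplus n 0 0 0} ⊆ (sZeroLie n : Set MatOp) :=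
    Set.subset_union_right.trans LieSubalgebra.subset_lieSpan
  rw [hsum]
  refine add_mem (add_mem ?_ ?_) ?_ <;>
    exact (sZeroLie n).smul_mem _ (hgen (by simp))

theorem range_planeSlRep (n : ℕ) : (planeSlRep n).range = sZeroLie n := by
  apply le_antisymm
  · rintro _ ⟨⟨⟨A, hA⟩, ⟨B, hB⟩⟩, rfl⟩
    have hadd : planeSlRep n (⟨A, hA⟩, ⟨B, hB⟩) =
        planeTensorRep n (A, 0) + planeTensorRep n (0, B) := by
      rw [← map_add, Prod.mk_add_mk, add_zero, zero_add]
      rfl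
    exact hadd ▸ add_mem (planeTensorRep_left_mem_sZeroLie n hA)
      (planeTensorRep_right_mem_sZeroLie n hB)
  · have hrange (A : Matrix (Fin 3) (Fin 3) ℂ) (B : Matrix (Fin 2) (Fin 2) ℂ)
        (hA : A.trace = 0) (hB : B.trace = 0) : planeTensorRep n (A, B) ∈ (planeSlRep n).range :=
      ⟨(⟨A, hA⟩, ⟨B, hB⟩), rfl⟩
    refine LieSubalgebra.lieSpan_le.2 ?_
    rintro _ (⟨i, rfl⟩ | rfl | rfl | rfl)
    · exact planeTensorRep_slBasis n i ▸ hrange _ _ (trace_slBasis i) (by simp)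
    · exact planeTensorRep_diagonal n ▸ hrange _ _ (by simp) (by simp)
    · exact planeTensorRep_single_one_zero n ▸ hrange _ _ (by simp) (by simp)
    · exact planeTensorRep_single_zero_one n ▸ hrange _ _ (by simp) (by simp)

theorem nonempty_sZeroLie_equiv (n : ℕ) :
    Nonempty (sZeroLie n ≃ₗ⁅ℂ⁆ sl (Fin 3) ℂ × sl (Fin 2) ℂ) :=
  range_planeSlRep n ▸ ⟨(LieEquiv.ofInjective (planeSlRep n) (planeSlRep_injective n)).symm⟩

end Triangular

/-! ### The case `Δ ≥ 2` -/

section CanonicalCommutation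

open SuperMatrix

variable {R : Type*} [Ring R] [Algebra ℂ R] {d x : R}

theorem aeval_mul_eq_mul_aeval_add (h : d * x = x * d + 1) (p : Polynomial ℂ) :
    Polynomial.aeval d p * x = x * Polynomial.aeval d p + Polynomial.aeval d p.derivative := by
  induction p using Polynomial.induction_on' with
  | add p q hp hq =>
    simp only [map_add, add_mul, mul_add, hp, hq]
    abel
  | monomial n a =>
    induction n with
    | zero => simp [Algebra.commutes]
    | succ n ih =>
      rw [← Polynomial.monomial_mul_X, Polynomial.derivative_mul, Polynomial.derivative_X]
      simp only [map_mul, map_add, Polynomial.aeval_X, mul_one]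
      rw [mul_assoc, h, mul_add, ← mul_assoc, ih, mul_one, add_mul, mul_assoc, add_assoc]

theorem transcendental_of_mul_eq_mul_add_one [Nontrivial R] (h : d * x = x * d + 1) :
    Transcendental ℂ d := by
  rw [transcendental_iff]
  intro p hp
  induction hn : p.natDegree using Nat.strong_induction_on generalizing p with
  | _ n ih =>
    have hderiv : Polynomial.aeval d p.derivative = 0 := by
      simpa [hp] using (aeval_mul_eq_mul_aeval_add h p).symm
    have hdeg : p.natDegree = 0 := by
      by_contra hdeg
      exact hdeg (Polynomial.derivative_eq_zero.1
        (ih _ (hn ▸ Polynomial.natDegree_derivative_lt hdeg) _ hderiv rfl))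
    rw [Polynomial.eq_C_of_natDegree_eq_zero hdeg] at hp ⊢
    simpa using hp

theorem linearIndependent_pow_of_mul_eq_mul_add_one [Nontrivial R] (h : d * x = x * d + 1) :
    LinearIndependent ℂ fun n : ℕ => d ^ n := by
  have hker : LinearMap.ker (Polynomial.aeval d : Polynomial ℂ →ₐ[ℂ] R).toLinearMap = ⊥ :=
    LinearMap.ker_eq_bot.2
      (transcendental_iff_injective.1 (transcendental_of_mul_eq_mul_add_one h))
  simpa [Function.comp_def] using (Polynomial.basisMonomials ℂ).linearIndependent.map' _ hker

theorem pow_succ_lie_mul_pow (h : d * x = x * d + 1) (m l : ℕ) :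
    ⁅d ^ (m + 1), x * d ^ l⁆ = ((m : ℂ) + 1) • d ^ (m + l) := by
  have hpow : d ^ (m + 1) * x = x * d ^ (m + 1) + ((m : ℂ) + 1) • d ^ m := by
    simpa [Algebra.smul_def] using aeval_mul_eq_mul_aeval_add h (Polynomial.X ^ (m + 1))
  rw [Ring.lie_def, ← mul_assoc, hpow, add_mul, mul_assoc, mul_assoc, ← pow_add, ← pow_add,
    add_comm l, add_sub_cancel_left, smul_mul_assoc, ← pow_add]

theorem pow_succ_lie_pow_mul (h : d * x = x * d + 1) (m l : ℕ) :
    ⁅d ^ (m + 1), d ^ l * x⁆ = ((m : ℂ) + 1) • d ^ (m + l) := by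
  have hlie : ⁅d ^ (m + 1), d ^ l * x⁆ = d ^ l * ⁅d ^ (m + 1), x⁆ := by
    rw [Ring.lie_def, Ring.lie_def, mul_sub, ← mul_assoc, ← mul_assoc, ← mul_assoc, ← pow_add,
      ← pow_add, add_comm]
  have hpow : ⁅d ^ (m + 1), x⁆ = ((m : ℂ) + 1) • d ^ m := by
    simpa using pow_succ_lie_mul_pow h m 0
  rw [hlie, hpow, mul_smul_comm, ← pow_add, add_comm l]

theorem SuperMatrix.superComm_upper_lower (a b : R) :
    superComm ![0, 1] !![0, a; 0, 0] !![0, 0; b, 0] = !![a * b, 0; 0, b * a] := by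
  have ha : !![0, a; 0, 0] ∈ degreePart R ![0, 1] 1 := by
    intro i j; fin_cases i <;> fin_cases j <;> simp
  have hb : !![0, 0; b, 0] ∈ degreePart R ![0, 1] 1 := by
    intro i j; fin_cases i <;> fin_cases j <;> simp
  rw [superComm_of_mem _ ha hb]
  simp [superSign]

theorem SuperMatrix.superComm_diagonal (a b a' b' : R) :
    superComm ![0, 1] !![a, 0; 0, b] !![a', 0; 0, b'] = !![⁅a, a'⁆, 0; 0, ⁅b, b'⁆] := by
  have hdiag (a b : R) : !![a, 0; 0, b] ∈ degreePart R ![0, 1] 0 := by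
    intro i j; fin_cases i <;> fin_cases j <;> simp [CharTwo.add_self_eq_zero]
  rw [superComm_of_mem _ (hdiag a b) (hdiag a' b')]
  ext i j
  fin_cases i <;> fin_cases j <;> simp [superSign, Ring.lie_def]

theorem diagonal_pow_mem (h : d * x = x * d + 1) {S : (lieSuperalgebra R ![0, 1]).Sub} {l : ℕ}
    (hone : !![0, 0; 1, 0] ∈ S.toSubmodule) (hx : !![0, 0; x, 0] ∈ S.toSubmodule)
    (hd : !![0, d ^ (l + 1); 0, 0] ∈ S.toSubmodule) (k : ℕ) :
    !![d ^ ((k + 1) * l + 1), 0; 0, d ^ ((k + 1) * l + 1)] ∈ S.toSubmodule := by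
  have hbracket {M N : Matrix (Fin 2) (Fin 2) R} (hM : M ∈ S.toSubmodule)
      (hN : N ∈ S.toSubmodule) : superComm ![0, 1] M N ∈ S.toSubmodule :=
    S.bracket_mem M hM N hN
  induction k with
  | zero => simpa [superComm_upper_lower] using hbracket hd hone
  | succ k ih =>
    have hmem := hbracket ih (hbracket hd hx)
    rw [superComm_upper_lower, superComm_diagonal, pow_succ_lie_mul_pow h,
      pow_succ_lie_pow_mul h] at hmem
    have hsmul : !![((((k + 1) * l : ℕ) : ℂ) + 1) • d ^ ((k + 1) * l + (l + 1)), 0;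
          0, ((((k + 1) * l : ℕ) : ℂ) + 1) • d ^ ((k + 1) * l + (l + 1))] =
        ((((k + 1) * l : ℕ) : ℂ) + 1) •
          !![d ^ ((k + 1) * l + (l + 1)), 0; 0, d ^ ((k + 1) * l + (l + 1))] := by
      simp
    rw [hsmul, Submodule.smul_mem_iff _ (Nat.cast_add_one_ne_zero _), ← add_assoc,
      ← Nat.succ_mul] at hmem
    exact hmem

theorem not_finiteDimensional_of_mem [Nontrivial R] (h : d * x = x * d + 1)
    {S : (lieSuperalgebra R ![0, 1]).Sub} {l : ℕ} (hl : l ≠ 0)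
    (hone : !![0, 0; 1, 0] ∈ S.toSubmodule) (hx : !![0, 0; x, 0] ∈ S.toSubmodule)
    (hd : !![0, d ^ (l + 1); 0, 0] ∈ S.toSubmodule) :
    ¬ FiniteDimensional ℂ S.toSubmodule := by
  intro hfin
  have hinj : Function.Injective fun k : ℕ => (k + 1) * l + 1 := fun a b hab =>
    Nat.succ_injective (Nat.eq_of_mul_eq_mul_right (Nat.pos_of_ne_zero hl)
      (Nat.succ_injective hab))
  let v (k : ℕ) : S.toSubmodule := ⟨_, diagonal_pow_mem h hone hx hd k⟩
  have hv : LinearIndependent ℂ v :=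
    .of_comp (Matrix.entryLinearMap ℂ R 0 0 ∘ₗ S.toSubmodule.subtype)
      ((linearIndependent_pow_of_mul_eq_mul_add_one h).comp _ hinj)
  exact not_finite_iff_infinite.2 inferInstance hv.finite

end CanonicalCommutation

namespace Triangular

open PolyEnd

theorem not_finiteDimensional_s {n Δ : ℕ} (hΔ : 2 ≤ Δ) :
    ¬ FiniteDimensional ℂ (s n Δ).toSubmodule := by
  obtain ⟨l, rfl⟩ := Nat.exists_eq_add_of_le' (one_le_two.trans hΔ)
  have hgen : generators n (l + 1) ⊆ (s n (l + 1)).toSubmodule := matOpSuper.subset_lieSpan _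
  have hminus (α β : ℕ) (h : α + β ≤ l + 1) : Qminus α β ∈ (s n (l + 1)).toSubmodule :=
    hgen (.inl (.inr ⟨α, β, h, rfl⟩))
  have hplus : Qplus n (l + 1) (l + 1) 0 ∈ (s n (l + 1)).toSubmodule :=
    hgen (.inr ⟨l + 1, 0, le_rfl, rfl⟩)
  exact not_finiteDimensional_of_mem dx_mul_x (by omega : l ≠ 0)
    (by simpa [Qminus, q] using hminus 0 0 (by omega))
    (by simpa [Qminus, q] using hminus 1 0 (by omega))
    (by simpa [Qplus, qbar] using hplus)

theorem finiteDimensional_s_iff (n Δ : ℕ) :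
    FiniteDimensional ℂ (s n Δ).toSubmodule ↔ Δ ≤ 1 := by
  refine ⟨fun h => ?_, fun h => ?_⟩
  · by_contra! hΔ
    exact not_finiteDimensional_s hΔ h
  · interval_cases Δ
    exacts [finiteDimensional_s_zero n, finiteDimensional_s_one n]

end Triangular

end

theorem mainTheorem9_general :
    (∀ n Δ : ℕ, FiniteDimensional ℂ (Triangular.s n Δ).toSubmodule ↔ Δ ≤ 1) ∧
    (∀ n : ℕ, 1 ≤ n →
      Nonempty (LieSuperalgebra.Iso (Triangular.s n 1).toLieSuperalgebra
        (spl 3 1).toLieSuperalgebra)) ∧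
    (∀ n : ℕ,
      Nonempty (Triangular.sZeroLie n ≃ₗ⁅ℂ⁆
        (LieAlgebra.SpecialLinear.sl (Fin 3) ℂ × LieAlgebra.SpecialLinear.sl (Fin 2) ℂ))) :=
  ⟨Triangular.finiteDimensional_s_iff, fun _ hn => Triangular.nonempty_iso_spl hn,
    Triangular.nonempty_sZeroLie_equiv⟩

theorem mainTheorem9 :
    (∀ n Δ : ℕ, Δ ≤ n →
      (FiniteDimensional ℂ (Triangular.s n Δ).toSubmodule ↔ Δ ≤ 1)) ∧
    (∀ n : ℕ, 1 ≤ n →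
      Nonempty (LieSuperalgebra.Iso (Triangular.s n 1).toLieSuperalgebra
        (spl 3 1).toLieSuperalgebra)) ∧
    (∀ n : ℕ,
      Nonempty (Triangular.sZeroLie n ≃ₗ⁅ℂ⁆
        (LieAlgebra.SpecialLinear.sl (Fin 3) ℂ × LieAlgebra.SpecialLinear.sl (Fin 2) ℂ))) :=
  ⟨fun n Δ _ => mainTheorem9_general.1 n Δ, mainTheorem9_general.2⟩
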